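/- Let $n\ge 0$, and consider representations of $S_n$ over $\mathbb C$. Partitions of $n$ index the conjugacy classes of $S_n$, a fixed point counting as a cycle of length $1$; let $\mathrm{Par}_n^{odd}$ be the set of partitions of $n$ with all parts odd. For a partition $\lambda\vdash n$ let $\sigma_\lambda\in S_n$ have cycle type $\lambda$, let $Z_\lambda$ be its centraliser in $S_n$, and let $\mathrm{tw}_\lambda: Z_\lambda\to\{\pm1\}$ be the linear character $$\mathrm{tw}_\lambda(g)=\prod_{i\ge 1}\operatorname{sgn}\bigl(g \text{ acting on the set of cycles of length } i \text{ of } \sigma_\lambda\bigr).$$ The twisted conjugacy module is $$\varepsilon(S_n)=\bigoplus_{\lambda\vdash n}\mathrm{tw}_\lambda\uparrow_{Z_\lambda}^{S_n}.$$ For a representation $V$ of $S_n$ with character $\chi_V$ let $ch(V)=\frac1{n!}\sum_{g\in S_n}\chi_V(g)\,p_{\mathrm{type}(g)}$ be its Frobenius characteristic, where $p_\lambda=\prod_j p_{\lambda_j}$ is the power-sum symmetric function. Let $f_i=ch(1\uparrow_{C_i}^{S_i})$ for $i\geq 1$, where $C_i$ is generated by an $i$-cycle, let $e_m$ be the elementary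 symmetric functions, and let $e_m[f_i]$ denote plethysm. Then: 1. $$ch(\varepsilon(S_n))=\sum_{\lambda\vdash n}\ \prod_{i} e_{m_i(\lambda)}[f_i]=\sum_{\lambda\in \mathrm{Par}_n^{odd}}p_\lambda,$$ where $i$ runs over the distinct parts of $\lambda$ and $m_i(\lambda)$ is the multiplicity of $i$ in $\lambda$. 2. $\varepsilon(S_n)$ is self-conjugate, that is, $\varepsilon(S_n)\otimes\mathrm{sgn}\cong\varepsilon(S_n)$, and it has degree $n!$. 3. If $\chi^\nu$ denotes the irreducible character of $S_n$ indexed by the partition $\nu$ of $n$, and $\chi^\nu(\lambda)$ its value on the class of cycle type $\lambda$, then for every $\nu\vdash n$ the sum $\sum_{\lambda\in \mathrm{Par}_n^{odd}}\chi^\nu(\lambda)$ is a nonnegative integer. -/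

import Mathlib

noncomputable section

namespace TwistedConj

open Equiv Equiv.Perm
open scoped Pointwise

/-! ### Partitions and cycle types -/

/-- `σ` has cycle type `l`, where fixed points are counted as parts equal to `1`. -/
def HasType {n : ℕ} (σ : Perm (Fin n)) (l : n.Partition) : Prop :=
  σ.partition.parts = l.parts

theorem exists_hasType {n : ℕ} (l : n.Partition) : ∃ σ : Perm (Fin n), HasType σ l := by
  have hle : (l.parts.filter (2 ≤ ·)).sum ≤ n := by
    have h := congrArg Multiset.sum (Multiset.filter_add_not (2 ≤ ·) l.parts)
    rw [Multiset.sum_add, l.parts_sum] at h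
    omega
  obtain ⟨σ, hσ⟩ := (Equiv.Perm.exists_with_cycleType_iff (Fin n)
    (m := l.parts.filter (2 ≤ ·))).2
      ⟨by simpa using hle, fun a ha => (Multiset.mem_filter.1 ha).2⟩
  refine ⟨σ, ?_⟩
  have hone : l.parts.filter (fun a => ¬ 2 ≤ a)
      = Multiset.replicate (Multiset.card (l.parts.filter (fun a => ¬ 2 ≤ a))) 1 := by
    refine Multiset.eq_replicate_card.2 fun b hb => ?_
    have h1 := l.parts_pos (Multiset.mem_filter.1 hb).1
    have h2 := (Multiset.mem_filter.1 hb).2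
    omega
  have h := congrArg Multiset.sum (Multiset.filter_add_not (2 ≤ ·) l.parts)
  rw [Multiset.sum_add, l.parts_sum, hone, Multiset.sum_replicate, smul_eq_mul, mul_one,
    ← hσ, Equiv.Perm.sum_cycleType] at h
  unfold HasType
  rw [Equiv.Perm.parts_partition, Fintype.card_fin]
  conv_rhs => rw [← Multiset.filter_add_not (2 ≤ ·) l.parts, hone]
  rw [hσ]
  congr 2
  omega

/-- A representative of the conjugacy class of cycle type `l`. -/
def rep {n : ℕ} (l : n.Partition) : Perm (Fin n) := (exists_hasType l).choose

theorem rep_hasType {n : ℕ} (l : n.Partition) : HasType (rep l) l := (exists_hasType l).choose_spec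

/-! ### The sign twist on a centraliser -/

/-- The underlying sets of the cycles of `σ` of length `i`; the cycles of length `1` are the
fixed points. -/
def cyclesOfLength {n : ℕ} (σ : Perm (Fin n)) (i : ℕ) : Finset (Finset (Fin n)) :=
  (Finset.univ.image fun x => Finset.univ.filter fun y => σ.SameCycle x y).filter
    fun c => c.card = i

theorem smul_mem_cyclesOfLength {n : ℕ} (σ g : Perm (Fin n)) (hg : g * σ = σ * g) (i : ℕ)
    {c : Finset (Fin n)} (hc : c ∈ cyclesOfLength σ i) : g • c ∈ cyclesOfLength σ i := by
  simp only [cyclesOfLength, Finset.mem_filter, Finset.mem_image, Finset.mem_univ,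
    true_and] at hc ⊢
  obtain ⟨⟨x, rfl⟩, hi⟩ := hc
  refine ⟨⟨g x, ?_⟩, by simpa using hi⟩
  have hconj : g * σ * g⁻¹ = σ := by rw [hg, mul_inv_cancel_right]
  ext y
  rw [← Finset.inv_smul_mem_iff]
  simp only [Finset.mem_filter, Finset.mem_univ, true_and, Equiv.Perm.smul_def]
  conv_lhs => rw [← hconj, sameCycle_conj]
  simp

theorem smul_mem_cyclesOfLength_iff {n : ℕ} (σ : Perm (Fin n))
    (g : Subgroup.centralizer {σ}) (i : ℕ) (c : Finset (Fin n)) :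
    MulAction.toPermHom (Perm (Fin n)) (Finset (Fin n)) g c ∈ cyclesOfLength σ i ↔
      c ∈ cyclesOfLength σ i := by
  have hg : (g : Perm (Fin n)) * σ = σ * g := Subgroup.mem_centralizer_singleton_iff.1 g.2
  refine ⟨fun h => ?_, fun h => smul_mem_cyclesOfLength σ g hg i h⟩
  have hg' : (g : Perm (Fin n))⁻¹ * σ = σ * (g : Perm (Fin n))⁻¹ := by
    rw [inv_mul_eq_iff_eq_mul, ← mul_assoc, hg, mul_inv_cancel_right]
  simpa using smul_mem_cyclesOfLength σ _ hg' i h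

/-- The centraliser of `σ` permutes the cycles of `σ` of length `i`. -/
def cycleAction {n : ℕ} (σ : Perm (Fin n)) (i : ℕ) :
    Subgroup.centralizer {σ} →* Perm {c // c ∈ cyclesOfLength σ i} where
  toFun g := (MulAction.toPermHom (Perm (Fin n)) (Finset (Fin n)) g).subtypePerm
    (smul_mem_cyclesOfLength_iff σ g i)
  map_one' := by ext; simp
  map_mul' g h := by
    refine Equiv.ext fun c => Subtype.ext ?_
    exact mul_smul (g : Perm (Fin n)) (h : Perm (Fin n)) (c : Finset (Fin n))

/-- The linear character of the centraliser of `σ` which, for every `i`, permutes the cycles of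
length `i` by the sign and is trivial within each cycle. -/
def twistSign {n : ℕ} (σ : Perm (Fin n)) : Subgroup.centralizer {σ} →* ℤˣ :=
  ∏ i ∈ Finset.Icc 1 n, sign.comp (cycleAction σ i)

/-- The one-dimensional complex representation given by a character with values in `{1, -1}`. -/
def linRep {G : Type} [Group G] (χ : G →* ℤˣ) : Representation ℂ G ℂ where
  toFun g := ((χ g : ℤ) : ℂ) • LinearMap.id
  map_one' := by ext; simp
  map_mul' g h := by ext; simp [mul_comm]

/-! ### The twisted conjugacy module -/

/-- The module induced to `S_n` from the centraliser of a permutation of cycle type `l`,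
where blocks of equal cycles are permuted by the sign. -/
abbrev twistedClass {n : ℕ} (l : n.Partition) :=
  Representation.ind (Subgroup.centralizer {rep l}).subtype (linRep (twistSign (rep l)))

/-- The underlying space of the twisted conjugacy module. -/
abbrev TwistedSpace (n : ℕ) : Type :=
  DirectSum n.Partition fun l =>
    Representation.IndV (Subgroup.centralizer {rep l}).subtype (linRep (twistSign (rep l)))

/-- The twisted conjugacy module `ε(S_n)`: the sum of the modules induced from the centralisers,
over all conjugacy classes. -/
abbrev twistedConj (n : ℕ) : Representation ℂ (Perm (Fin n)) (TwistedSpace n) :=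
  Representation.directSum fun l : n.Partition => twistedClass l

/-- The sign representation of `S_n`. -/
abbrev sgnRep (n : ℕ) : Representation ℂ (Perm (Fin n)) ℂ := linRep sign

/-- The permutation module `1↑_{C_n}^{S_n}`, where `C_n` is generated by an `n`-cycle. -/
abbrev indCyclic (n : ℕ) :=
  Representation.ind (Subgroup.zpowers (finRotate n)).subtype
    (Representation.trivial ℂ (Subgroup.zpowers (finRotate n)) ℂ)

/-! ### Symmetric functions, as formal power series in `x₀, x₁, x₂, …` -/

/-- The power sum `p_k = ∑ᵢ xᵢ ^ k`, for `k ≥ 1`. -/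
def pSym (k : ℕ) : MvPowerSeries ℕ ℂ :=
  open Classical in fun m => if ∃ i, m = Finsupp.single i k then 1 else 0

/-- The elementary symmetric function `e_k`, the sum of all squarefree monomials of degree `k`. -/
def eSym (k : ℕ) : MvPowerSeries ℕ ℂ :=
  open Classical in fun m => if (∀ i, m i ≤ 1) ∧ m.degree = k then 1 else 0

/-- The power sum `p_l = ∏ p_{l_i}` of a partition. -/
def pPart {n : ℕ} (l : n.Partition) : MvPowerSeries ℕ ℂ := (l.parts.map pSym).prod

/-- The Frobenius characteristic `(1 / n!) ∑_g χ(g) p_{type g}` of a representation of `S_n`. -/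
def frob {n : ℕ} {V : Type} [AddCommGroup V] [Module ℂ V]
    (ρ : Representation ℂ (Perm (Fin n)) V) : MvPowerSeries ℕ ℂ :=
  (n.factorial : ℂ)⁻¹ • ∑ g : Perm (Fin n), ρ.character g • pPart g.partition

/-- The plethysm `f[g]`: write `f` as a polynomial in the power sums `p_k`, and replace each `p_k`
by `p_k[g] = g(x₀ ^ k, x₁ ^ k, …)`. -/
def plethysm (f g : MvPowerSeries ℕ ℂ) : MvPowerSeries ℕ ℂ :=
  open Classical in
  if h : ∃ P : MvPolynomial ℕ+ ℂ, MvPolynomial.aeval (fun k : ℕ+ => pSym k) P = f then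
    MvPolynomial.aeval (fun k : ℕ+ => MvPowerSeries.expand (k : ℕ) k.ne_zero g) h.choose
  else 0

/-- `E_l[Q] = ∏ e_{m_i}[q_i]`, over the parts `i` of `l`, `m_i` being the multiplicity of `i`. -/
def ePleth {n : ℕ} (l : n.Partition) (q : ℕ → MvPowerSeries ℕ ℂ) : MvPowerSeries ℕ ℂ :=
  ∏ i ∈ l.parts.toFinset, plethysm (eSym (l.parts.count i)) (q i)

/-! ### The irreducible characters of `S_n` -/

/-- The parts of `ν` in weakly decreasing order. -/
def rowLens {n : ℕ} (ν : n.Partition) : List ℕ := ν.parts.sort (· ≥ ·)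

theorem sum_rowLens {n : ℕ} (ν : n.Partition) :
    ∑ r : Fin (rowLens ν).length, (rowLens ν).get r = n := by
  have h : ((rowLens ν : List ℕ) : Multiset ℕ).sum = n := by
    rw [rowLens, Multiset.sort_eq, ν.parts_sum]
  rw [Multiset.sum_coe] at h
  simpa [Fin.sum_univ_getElem] using h

/-- The tableau of shape `ν` filled with `0, …, n - 1` row by row: the cell `⟨r, c⟩` is the `c`-th
cell of the `r`-th row. -/
def tableau {n : ℕ} (ν : n.Partition) :
    (Σ r : Fin (rowLens ν).length, Fin ((rowLens ν).get r)) ≃ Fin n :=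
  finSigmaFinEquiv.trans (finCongr (sum_rowLens ν))

/-- The row of the entry `x` of the tableau. -/
def rowOf {n : ℕ} (ν : n.Partition) (x : Fin n) : ℕ := ((tableau ν).symm x).1

/-- The column of the entry `x` of the tableau. -/
def colOf {n : ℕ} (ν : n.Partition) (x : Fin n) : ℕ := ((tableau ν).symm x).2

/-- The Young symmetrizer `(∑_{g ∈ P} g) (∑_{h ∈ Q} sgn(h) h)`, where `P` and `Q` are the row and
the column group of the tableau. -/
def youngSymmetrizer {n : ℕ} (ν : n.Partition) : MonoidAlgebra ℂ (Perm (Fin n)) :=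
  (∑ g : Perm (Fin n) with ∀ x, rowOf ν (g x) = rowOf ν x, MonoidAlgebra.of ℂ _ g) *
  (∑ h : Perm (Fin n) with ∀ x, colOf ν (h x) = colOf ν x,
    ((sign h : ℤ) : ℂ) • MonoidAlgebra.of ℂ _ h)

/-- The irreducible (Specht) module of `S_n` indexed by `ν`: the left ideal of the group algebra
generated by the Young symmetrizer. -/
abbrev specht {n : ℕ} (ν : n.Partition) :=
  Representation.ofModule' (k := ℂ) (G := Perm (Fin n))
    ↥(Ideal.span {youngSymmetrizer ν} : Ideal (MonoidAlgebra ℂ (Perm (Fin n))))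

/-- The value `χ^ν(l)` of the irreducible character indexed by `ν` on the class of type `l`. -/
def irrChar {n : ℕ} (ν l : n.Partition) : ℂ := (specht ν).character (rep l)

end TwistedConj

end

/-!
The twisting character at `g` is `sgn σ · (-1) ^ (n + r)`, where `r` is the number of orbits of
`⟨σ, g⟩`, so the character of `ε(S_n)` at `g` is the sum of these signs over all `σ` commuting with
`g`. If every cycle of `g` is odd, then `g` has odd order, every sign is `1`, and the sum is
`|Z(g)|`. If `g` has an even cycle `γ`, then `σ ↦ σ * γ` keeps the orbits of `⟨σ, g⟩` and flips
`sgn σ`, so the sum vanishes. The Frobenius characteristic, the degree and the self-conjugacy can be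
read off, and `∑ χ^ν(λ)` is the dimension of a space of intertwining maps.

For the plethystic sum, the generating function over all partitions is `∏ᵢ Eᵢ(tⁱ)`, where
`Eᵢ(t) = ∑ e_c[f_i] t^c`. Its logarithmic derivative is computed from
`f_i = i⁻¹ ∑_{d ∣ i} φ(d) p_d^{i/d}`, and it agrees with the one for the power sums over odd
partitions because `∑_{kd = m} (-1)^(k-1) φ(d)` is `m` for odd `m` and `0` for even `m`.
-/

noncomputable section

namespace TwistedConj

open Equiv Equiv.Perm Representation

open scoped Pointwise

section CharacterInd

variable {k G : Type*} [Field k] [Group G]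

theorem character_directSum {ι : Type*} [Fintype ι] {V : ι → Type*}
    [∀ i, AddCommGroup (V i)] [∀ i, Module k (V i)] [∀ i, FiniteDimensional k (V i)]
    (ρ : ∀ i, Representation k G (V i)) (g : G) :
    (directSum ρ).character g = ∑ i, (ρ i).character g := by
  classical
  have : Module.Finite k (DirectSum ι V) :=
    Module.Finite.equiv (DirectSum.linearEquivFunOnFintype k ι V).symm
  have component_lof (i : ι) :
      DirectSum.component k ι V i ∘ₗ DirectSum.lof k ι V i = LinearMap.id :=
    LinearMap.ext fun x => DirectSum.component.lof_self k i x
  have directSum_eq_sum : directSum ρ g =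
      ∑ i, DirectSum.lof k ι V i ∘ₗ (ρ i g ∘ₗ DirectSum.component k ι V i) := by
    refine LinearMap.ext fun x => DirectSum.ext_component k fun j => ?_
    simp only [LinearMap.coe_sum, Finset.sum_apply, map_sum, LinearMap.comp_apply]
    rw [Finset.sum_eq_single_of_mem j (Finset.mem_univ j) fun i _ hij =>
      (DirectSum.component.of k _ _ _).trans (dif_neg hij), DirectSum.component.lof_self]
    rfl
  rw [character, directSum_eq_sum, map_sum]
  refine Finset.sum_congr rfl fun i _ => ?_
  rw [LinearMap.trace_comp_comm', LinearMap.comp_assoc, component_lof, LinearMap.comp_id, character]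

theorem trace_coinvariants_map [Fintype G] {V : Type*} [AddCommGroup V] [Module k V]
    [FiniteDimensional k V] [Invertible (Fintype.card G : k)] (τ : Representation k G V)
    (f : IntertwiningMap τ τ) :
    LinearMap.trace k _ (Coinvariants.map τ τ f) =
      (Fintype.card G : k)⁻¹ * ∑ h : G, LinearMap.trace k V (f.toLinearMap ∘ₗ τ h) := by
  have averageMap_eq : averageMap τ = (Fintype.card G : k)⁻¹ • ∑ h : G, τ h := by
    simp [GroupAlgebra.average]
  have averageMap_comp (x : G) : averageMap τ ∘ₗ τ x = averageMap τ := by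
    rw [averageMap, ← asAlgebraHom_single_one, ← Module.End.mul_eq_comp, ← map_mul,
      GroupAlgebra.mul_average_right]
  have section_eq : Coinvariants.mk τ ∘ₗ Coinvariants.lift τ (averageMap τ) averageMap_comp =
      LinearMap.id := by
    refine Coinvariants.hom_ext (LinearMap.ext fun v => ?_)
    simp only [LinearMap.comp_apply, Coinvariants.lift_mk, averageMap_eq, LinearMap.smul_apply,
      LinearMap.sum_apply, map_smul, map_sum, Coinvariants.mk_self_apply, LinearMap.id_apply,
      Finset.sum_const, Finset.card_univ]
    rw [← Nat.cast_smul_eq_nsmul k, smul_smul, inv_mul_cancel₀ (Invertible.ne_zero _), one_smul]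
  calc LinearMap.trace k _ (Coinvariants.map τ τ f)
      = LinearMap.trace k _ (Coinvariants.mk τ ∘ₗ f.toLinearMap ∘ₗ
          Coinvariants.lift τ (averageMap τ) averageMap_comp) := by
        rw [← LinearMap.comp_id (Coinvariants.map τ τ f), ← section_eq, ← LinearMap.comp_assoc,
          Coinvariants.map_comp_mk, LinearMap.comp_assoc]
        rfl
    _ = LinearMap.trace k V (f.toLinearMap ∘ₗ averageMap τ) := by
        rw [LinearMap.trace_comp_comm', LinearMap.comp_assoc, Coinvariants.lift_comp_mk]
    _ = _ := by
        rw [averageMap_eq, LinearMap.comp_smul, map_smul, smul_eq_mul]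
        simp only [← Module.End.mul_eq_comp, Finset.mul_sum, map_sum]

theorem character_ind {H : Type*} [Fintype G] [Fintype H] [DecidableEq H] [Group H]
    [Invertible (Fintype.card G : k)] (φ : G →* H) {A : Type*} [AddCommGroup A] [Module k A]
    [FiniteDimensional k A] (ρ : Representation k G A) (g : H) :
    (ind φ ρ).character g = (Fintype.card G : k)⁻¹ *
      ∑ h : G, ρ.character h * (Fintype.card {x : H // φ h * x = x * g} : k) := by
  have : Module.Finite k (MonoidAlgebra k H) :=
    Module.Finite.equiv (MonoidAlgebra.coeffLinearEquiv k).symm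
  rw [character, ind_apply, trace_coinvariants_map]
  congr 1
  refine Finset.sum_congr rfl fun h _ => ?_
  have comp_eq_map : (MonoidAlgebra.mapDomainLinearMap k k fun x : H => x * g⁻¹).rTensor A ∘ₗ
      (Representation.tprod ((leftRegular k H).comp φ) ρ) h =
      TensorProduct.map
        (MonoidAlgebra.mapDomainLinearMap k k fun x : H => φ h * x * g⁻¹) (ρ h) := by
    ext; simp
  refine (congrArg _ comp_eq_map).trans ?_
  rw [LinearMap.trace_tensorProduct', mul_comm, character]
  congr 1
  rw [LinearMap.trace_eq_matrix_trace k (MonoidAlgebra.basis H k), Matrix.trace,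
    Fintype.card_subtype, Finset.natCast_card_filter]
  refine Finset.sum_congr rfl fun x _ => ?_
  rw [Matrix.diag_apply, LinearMap.toMatrix_apply]
  simp [MonoidAlgebra.basis, Finsupp.single_apply, mul_inv_eq_iff_eq_mul]

end CharacterInd

section CharacterIso

universe u

variable {k R : Type*} [Field k] [Ring R] [Algebra k R]

theorem finite_linearMap_of_isScalarTower (S V : Type*) [AddCommGroup S] [Module k S] [Module R S]
    [IsScalarTower k R S] [Module.Finite k S] [AddCommGroup V] [Module k V] [Module R V]
    [IsScalarTower k R V] [Module.Finite k V] : Module.Finite k (S →ₗ[R] V) :=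
  Module.Finite.of_injective (LinearMap.restrictScalarsₗ k R S V k)
    (LinearMap.restrictScalars_injective k)

theorem finite_submodule_of_isScalarTower {V : Type*} [AddCommGroup V] [Module k V] [Module R V]
    [IsScalarTower k R V] [Module.Finite k V] (S : Submodule R V) : Module.Finite k S :=
  inferInstanceAs (Module.Finite k (S.restrictScalars k))

/-- Postcomposition with an `R`-linear equivalence, as a map linear over the base field `k`;
`LinearEquiv.congrRight` needs `R` commutative. -/
def homCongrRight (k : Type*) [Field k] [Algebra k R] (T : Type*) {A B : Type*} [AddCommGroup T]
    [Module R T] [AddCommGroup A] [Module k A] [Module R A] [IsScalarTower k R A] [AddCommGroup B]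
    [Module k B] [Module R B] [IsScalarTower k R B] (e : A ≃ₗ[R] B) :
    (T →ₗ[R] A) ≃ₗ[k] (T →ₗ[R] B) where
  toFun f := e.toLinearMap ∘ₗ f
  invFun f := e.symm.toLinearMap ∘ₗ f
  left_inv f := by ext; simp
  right_inv f := by ext; simp
  map_add' f g := by ext; simp
  map_smul' c f := LinearMap.ext fun x => (e.restrictScalars k).map_smul c (f x)

theorem finrank_hom_of_prod_equiv (T : Type*) {A B C : Type*}
    [AddCommGroup T] [Module k T] [Module R T] [IsScalarTower k R T] [Module.Finite k T]
    [AddCommGroup A] [Module k A] [Module R A] [IsScalarTower k R A] [Module.Finite k A]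
    [AddCommGroup B] [Module k B] [Module R B] [IsScalarTower k R B] [Module.Finite k B]
    [AddCommGroup C] [Module k C] [Module R C] [IsScalarTower k R C] (e : (A × B) ≃ₗ[R] C) :
    Module.finrank k (T →ₗ[R] C) = Module.finrank k (T →ₗ[R] A) + Module.finrank k (T →ₗ[R] B) := by
  have := finite_linearMap_of_isScalarTower (k := k) (R := R) T A
  have := finite_linearMap_of_isScalarTower (k := k) (R := R) T B
  rw [← Module.finrank_prod, ((LinearMap.prodEquiv k).trans (homCongrRight k T e)).finrank_eq]

variable {V W : Type u} [AddCommGroup V] [Module k V] [Module R V] [IsScalarTower k R V]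
  [Module.Finite k V] [AddCommGroup W] [Module k W] [Module R W] [IsScalarTower k R W]

theorem subsingleton_of_finrank_end_eq_zero [Module.Finite k W]
    (h : Module.finrank k (W →ₗ[R] W) = 0) :
    Subsingleton W := by
  have := finite_linearMap_of_isScalarTower (k := k) (R := R) W W
  have := Module.finrank_zero_iff.1 h
  exact subsingleton_of_forall_eq 0 fun w =>
    LinearMap.congr_fun (Subsingleton.elim LinearMap.id (0 : W →ₗ[R] W)) w

theorem exists_common_summand [IsSemisimpleRing R] [Nontrivial V]
    (h : ∀ S : Submodule R V,
      Module.finrank k (S →ₗ[R] V) = Module.finrank k (S →ₗ[R] W)) :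
    ∃ (S V' : Submodule R V) (W' : Submodule R W), Nontrivial S ∧
      Nonempty ((S × V') ≃ₗ[R] V) ∧ Nonempty ((S × W') ≃ₗ[R] W) := by
  obtain ⟨S, hS⟩ := IsSemisimpleModule.exists_simple_submodule R V
  have nontrivial_S := IsSimpleModule.nontrivial R S
  obtain ⟨f, f_ne_zero⟩ : ∃ f : S →ₗ[R] W, f ≠ 0 := by
    by_contra! eq_zero
    have := finite_submodule_of_isScalarTower (k := k) S
    have := finite_linearMap_of_isScalarTower (k := k) (R := R) S V
    have : Subsingleton (S →ₗ[R] W) := subsingleton_of_forall_eq 0 eq_zero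
    have hom_S_V := h S
    rw [Module.finrank_zero_of_subsingleton (M := S →ₗ[R] W), Module.finrank_zero_iff] at hom_S_V
    obtain ⟨x, hx⟩ := exists_ne (0 : S)
    exact hx (Subtype.ext (LinearMap.congr_fun (Subsingleton.elim S.subtype 0) x))
  let e := LinearEquiv.ofInjective f ((LinearMap.injective_or_eq_zero f).resolve_right f_ne_zero)
  obtain ⟨V', hV'⟩ := exists_isCompl S
  obtain ⟨W', hW'⟩ := exists_isCompl (LinearMap.range f)
  exact ⟨S, V', W', nontrivial_S, ⟨Submodule.prodEquivOfIsCompl S V' hV'⟩,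
    ⟨(e.prodCongr (LinearEquiv.refl R W')).trans (Submodule.prodEquivOfIsCompl _ W' hW')⟩⟩

variable (V W) in
theorem nonempty_linearEquiv_of_finrank_hom_eq [IsSemisimpleRing R] [Module.Finite k W]
    (h : ∀ (S : Type u) [AddCommGroup S] [Module k S] [Module R S] [IsScalarTower k R S]
      [Module.Finite k S], Module.finrank k (S →ₗ[R] V) = Module.finrank k (S →ₗ[R] W)) :
    Nonempty (V ≃ₗ[R] W) := by
  induction hd : Module.finrank k V using Nat.strong_induction_on generalizing V W with
  | _ d ih =>
    rcases subsingleton_or_nontrivial V with _ | _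
    · have : Subsingleton W := subsingleton_of_finrank_end_eq_zero (k := k) (R := R) <| by
        rw [← h W, Module.finrank_zero_of_subsingleton]
      exact ⟨0⟩
    · have finite_sub := @finite_submodule_of_isScalarTower k R _ _ _
      obtain ⟨S, V', W', _, ⟨eV⟩, ⟨eW⟩⟩ := exists_common_summand (k := k) (V := V) (W := W)
        fun S => have := finite_sub S; h S
      have := finite_sub S
      have := finite_sub V'
      have := finite_sub W'
      have finrank_lt : Module.finrank k V' < d := by
        have finrank_V := (eV.restrictScalars k).finrank_eq
        have finrank_S : 0 < Module.finrank k S := Module.finrank_pos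
        rw [Module.finrank_prod] at finrank_V
        omega
      obtain ⟨e⟩ := ih _ finrank_lt V' W' (fun T _ _ _ _ _ => by
        have hom_T := h T
        rw [finrank_hom_of_prod_equiv T eV, finrank_hom_of_prod_equiv T eW] at hom_T
        omega) rfl
      exact ⟨eV.symm.trans (((LinearEquiv.refl R S).prodCongr e).trans eW)⟩

variable {G : Type*} [Group G]

variable (k G) in
/-- The `k[G]`-module attached to the representation that a `k[G]`-module `S` defines is `S`. -/
def ofModuleAsModuleEquiv (S : Type*) [AddCommGroup S] [Module k S] [Module (MonoidAlgebra k G) S]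
    [IsScalarTower k (MonoidAlgebra k G) S] :
    (ofModule' (k := k) (G := G) S).asModule ≃ₗ[MonoidAlgebra k G] S where
  toAddEquiv := (ofModule' (k := k) (G := G) S).asModuleEquiv.toAddEquiv
  map_smul' r x := by
    have asAlgebraHom_eq : (ofModule' (k := k) (G := G) S).asAlgebraHom = Algebra.lsmul k k S :=
      (MonoidAlgebra.lift k (S →ₗ[k] S) G).apply_symm_apply _
    exact congrArg (fun f => f r x) asAlgebraHom_eq

theorem card_inv_mul_sum_char_mul_char_eq_finrank_hom [Fintype G] [Invertible (Nat.card G : k)]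
    (ρ : Representation k G V) (S : Type*) [AddCommGroup S] [Module k S]
    [Module (MonoidAlgebra k G) S] [IsScalarTower k (MonoidAlgebra k G) S] [Module.Finite k S] :
    (Nat.card G : k)⁻¹ * ∑ g : G, ρ.character g * (ofModule' S).character g⁻¹ =
      Module.finrank k (S →ₗ[MonoidAlgebra k G] ρ.asModule) := by
  rw [card_inv_mul_sum_char_mul_char_eq_finrank,
    (IntertwiningMap.equivLinearMapAsModule _ ρ).finrank_eq,
    ((ofModuleAsModuleEquiv k G S).congrLeft ρ.asModule k).finrank_eq]

/-- The isomorphism of representations given by an isomorphism of modules over the group ring. -/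
def equivOfAsModuleEquiv {ρ : Representation k G V} {σ : Representation k G W}
    (e : ρ.asModule ≃ₗ[MonoidAlgebra k G] σ.asModule) : ρ.Equiv σ :=
  Representation.Equiv.mk (e.restrictScalars k) fun g => LinearMap.ext fun v => by
    have map_smul := e.map_smul (MonoidAlgebra.of k G g) (ρ.asModuleEquiv.symm v)
    rw [← asModuleEquiv_symm_map_rho] at map_smul
    exact map_smul.trans
      (asModuleEquiv_symm_map_rho σ g (σ.asModuleEquiv (e (ρ.asModuleEquiv.symm v)))).symm

theorem nonempty_equiv_of_character_eq [Finite G] [CharZero k] [Module.Finite k W]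
    (ρ : Representation k G V) (σ : Representation k G W) (h : ρ.character = σ.character) :
    Nonempty (ρ.Equiv σ) := by
  have := Fintype.ofFinite G
  have : NeZero (Nat.card G : k) := ⟨Nat.cast_ne_zero.2 Nat.card_pos.ne'⟩
  have : Invertible (Nat.card G : k) := invertibleOfNonzero (NeZero.ne _)
  obtain ⟨e⟩ := nonempty_linearEquiv_of_finrank_hom_eq (k := k) (R := MonoidAlgebra k G)
    ρ.asModule σ.asModule fun S _ _ _ _ _ => Nat.cast_injective (R := k) <| by
      rw [← card_inv_mul_sum_char_mul_char_eq_finrank_hom,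
        ← card_inv_mul_sum_char_mul_char_eq_finrank_hom, h]
  exact ⟨equivOfAsModuleEquiv e⟩

end CharacterIso

section Orbits

variable {α : Type*}

theorem sameCycle_setoid_le_iff {π : Perm α} {s : Setoid α} :
    SameCycle.setoid π ≤ s ↔ ∀ x, s x (π x) := by
  refine ⟨fun h x => h ⟨1, by simp⟩, fun h x y hxy => ?_⟩
  obtain ⟨k, rfl⟩ := hxy
  induction k with
  | zero => exact s.refl _
  | succ k ih =>
    rw [add_comm, zpow_one_add, Perm.mul_apply]
    exact s.trans ih (h _)
  | pred k ih =>
    refine s.trans ih (s.symm ?_)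
    simpa only [← Perm.mul_apply, ← zpow_one_add, add_sub_cancel] using
      h ((π ^ (-(k : ℤ) - 1)) x)

theorem card_quotient_congr {β : Type*} {s : Setoid α} {t : Setoid β} (f : α → β)
    (hf : Function.Surjective f) (h : ∀ x y, s x y ↔ t (f x) (f y)) :
    Nat.card (Quotient s) = Nat.card (Quotient t) := by
  refine Nat.card_congr (Equiv.ofBijective (Quotient.map f fun x y => (h x y).1) ⟨?_, ?_⟩)
  · rintro ⟨x⟩ ⟨y⟩ hxy
    exact Quotient.sound ((h x y).2 (Quotient.exact hxy))
  · rintro ⟨y⟩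
    obtain ⟨x, rfl⟩ := hf y
    exact ⟨Quotient.mk _ x, rfl⟩

theorem card_quotient_eq_sum_fiberwise [Finite α] {ι : Type*} (s : Setoid α) (len : α → ι)
    (t : Finset ι) (len_mem : ∀ x, len x ∈ t) (hlen : ∀ x y, s x y → len x = len y) :
    Nat.card (Quotient s) =
      ∑ i ∈ t, Nat.card (Quotient (s.comap (Subtype.val : {x // len x = i} → α))) := by
  classical
  have := Fintype.ofFinite (Quotient s)
  let len' : Quotient s → ι := Quotient.lift len hlen
  rw [Nat.card_eq_fintype_card, ← Finset.card_univ,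
    Finset.card_eq_sum_card_fiberwise (f := len') (t := t)]
  · refine Finset.sum_congr rfl fun i _ => ?_
    rw [← Fintype.card_subtype, ← Nat.card_eq_fintype_card]
    exact Nat.card_congr (Equiv.subtypeQuotientEquivQuotientSubtype (fun x => len x = i)
      (fun q => len' q = i) (fun _ => Iff.rfl) fun _ _ => Iff.rfl)
  · rintro ⟨x⟩ -
    exact len_mem x

theorem card_quotient_sameCycle [Fintype α] [DecidableEq α] (π : Perm α) :
    Nat.card (Quotient (SameCycle.setoid π)) =
      Multiset.card π.cycleType + (Fintype.card α - π.support.card) := by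
  let f (x : α) : {c // c ∈ π.cycleFactorsFinset} ⊕ Function.fixedPoints π :=
    if h : π x = x then .inr ⟨x, h⟩ else
      .inl ⟨π.cycleOf x, cycleOf_mem_cycleFactorsFinset_iff.2 (mem_support.2 h)⟩
  have f_surjective : Function.Surjective f := by
    rintro (⟨c, hc⟩ | ⟨x, hx⟩)
    · obtain ⟨x, hx⟩ := (mem_cycleFactorsFinset_iff.1 hc).1.nonempty_support
      have apply_ne := mem_support.1 (mem_cycleFactorsFinset_support_le hc hx)
      exact ⟨x, by simp only [f, dif_neg apply_ne, ← cycle_is_cycleOf hx hc]⟩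
    · exact ⟨x, dif_pos hx⟩
  have sameCycle_iff (x y : α) : π.SameCycle x y ↔ f x = f y := by
    by_cases hx : π x = x <;> by_cases hy : π y = y
    · simp only [f, dif_pos hx, dif_pos hy, Sum.inr.injEq]
      refine ⟨fun h => Subtype.ext (h.eq_of_left hx), fun h => ?_⟩
      obtain rfl : x = y := Subtype.ext_iff.1 h
      exact SameCycle.refl _ _
    · simpa [f, hx, hy] using fun h : π.SameCycle x y => hy (h.apply_eq_self_iff.1 hx)
    · simpa [f, hx, hy] using fun h : π.SameCycle x y => hx (h.apply_eq_self_iff.2 hy)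
    · simpa only [f, dif_neg hx, dif_neg hy, Sum.inl.injEq, Subtype.mk.injEq] using
        sameCycle_iff_cycleOf_eq_of_mem_support (mem_support.2 hx) (mem_support.2 hy)
  rw [card_quotient_congr (t := ⊥) f f_surjective sameCycle_iff,
    Nat.card_congr Setoid.quotientBotEquiv, Nat.card_sum, Nat.card_eq_fintype_card,
    Nat.card_eq_fintype_card, Fintype.card_coe, card_fixedPoints, sum_cycleType, cycleType_def,
    Multiset.card_map, Finset.card_def]

theorem sign_eq_neg_one_pow_card_quotient [Fintype α] [DecidableEq α] (π : Perm α) :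
    sign π = (-1) ^ (Fintype.card α + Nat.card (Quotient (SameCycle.setoid π))) := by
  obtain ⟨d, hd⟩ := Nat.exists_eq_add_of_le (Finset.card_le_univ π.support)
  rw [card_quotient_sameCycle, sign_of_cycleType, sum_cycleType, hd, Nat.add_sub_cancel_left,
    add_add_add_comm, pow_add _ _ (d + d), Even.neg_one_pow ⟨d, rfl⟩, mul_one]

/-- The equivalence relation whose classes are the orbits of the group generated by `σ` and `g`. -/
def jointSetoid (σ g : Perm α) : Setoid α := SameCycle.setoid σ ⊔ SameCycle.setoid g

/-- The number of orbits of the group generated by `σ` and `g`. -/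
def jointOrbits (σ g : Perm α) : ℕ := Nat.card (Quotient (jointSetoid σ g))

theorem jointSetoid_le_iff {σ g : Perm α} {s : Setoid α} :
    jointSetoid σ g ≤ s ↔ (∀ x, s x (σ x)) ∧ ∀ x, s x (g x) := by
  rw [jointSetoid, sup_le_iff, sameCycle_setoid_le_iff, sameCycle_setoid_le_iff]

theorem jointSetoid_apply_left (σ g : Perm α) (x : α) : jointSetoid σ g x (σ x) :=
  (jointSetoid_le_iff.1 le_rfl).1 x

theorem jointSetoid_apply_right (σ g : Perm α) (x : α) : jointSetoid σ g x (g x) :=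
  (jointSetoid_le_iff.1 le_rfl).2 x

theorem jointOrbits_one (σ : Perm α) :
    jointOrbits σ 1 = Nat.card (Quotient (SameCycle.setoid σ)) := by
  rw [jointOrbits, jointSetoid, sup_eq_left.2 (sameCycle_setoid_le_iff.2 fun x => Setoid.refl' _ x)]

theorem jointSetoid_conj_apply {σ g : Perm α} (x : Perm α) {a b : α} (h : jointSetoid σ g a b) :
    jointSetoid (x * σ * x⁻¹) (x * g * x⁻¹) (x a) (x b) := by
  refine (jointSetoid_le_iff (s := (jointSetoid (x * σ * x⁻¹) (x * g * x⁻¹)).comap x)).2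
    ⟨fun c => ?_, fun c => ?_⟩ h
  · simpa [Setoid.comap_rel] using jointSetoid_apply_left (x * σ * x⁻¹) (x * g * x⁻¹) (x c)
  · simpa [Setoid.comap_rel] using jointSetoid_apply_right (x * σ * x⁻¹) (x * g * x⁻¹) (x c)

theorem jointOrbits_conj (σ g x : Perm α) :
    jointOrbits (x * σ * x⁻¹) (x * g * x⁻¹) = jointOrbits σ g := by
  refine (card_quotient_congr x x.surjective
    fun a b => ⟨jointSetoid_conj_apply x, fun h => ?_⟩).symm
  have conj_back := jointSetoid_conj_apply x⁻¹ h
  rw [show x⁻¹ * (x * σ * x⁻¹) * x⁻¹⁻¹ = σ by group,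
    show x⁻¹ * (x * g * x⁻¹) * x⁻¹⁻¹ = g by group] at conj_back
  simpa using conj_back

theorem jointOrbits_mul_left {σ g γ : Perm α} (hγ : SameCycle.setoid γ ≤ SameCycle.setoid g) :
    jointOrbits (σ * γ) g = jointOrbits σ g := by
  have rel_apply (τ : Perm α) (x : α) : jointSetoid τ g x (γ x) :=
    (le_sup_of_le_right hγ : _ ≤ jointSetoid τ g) ⟨1, by simp⟩
  have setoid_eq : jointSetoid (σ * γ) g = jointSetoid σ g := by
    refine le_antisymm
      (jointSetoid_le_iff.2 ⟨fun x => ?_, jointSetoid_apply_right σ g⟩)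
      (jointSetoid_le_iff.2 ⟨fun x => ?_, jointSetoid_apply_right (σ * γ) g⟩)
    · exact Setoid.trans' _ (rel_apply σ x) (jointSetoid_apply_left σ g (γ x))
    · have left := jointSetoid_apply_left (σ * γ) g (γ⁻¹ x)
      have rel := rel_apply (σ * γ) (γ⁻¹ x)
      rw [Perm.mul_apply, show γ (γ⁻¹ x) = x by simp] at left
      rw [show γ (γ⁻¹ x) = x by simp] at rel
      exact Setoid.trans' _ (Setoid.symm' _ rel) left
  rw [jointOrbits, setoid_eq, jointOrbits]

theorem jointSetoid_iff_of_commute {σ g : Perm α} (h : Commute σ g) {x y : α} :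
    jointSetoid σ g x y ↔ ∃ k : ℤ, σ.SameCycle ((g ^ k) x) y := by
  constructor
  · intro hxy
    have sameCycle_zpow (k : ℤ) {a b : α} (hab : σ.SameCycle a b) :
        σ.SameCycle ((g ^ k) a) ((g ^ k) b) := by
      obtain ⟨l, rfl⟩ := hab
      exact ⟨l, by rw [← Perm.mul_apply, ← Perm.mul_apply, (h.zpow_zpow l k).eq]⟩
    let s : Setoid α :=
      { r x y := ∃ k : ℤ, σ.SameCycle ((g ^ k) x) y
        iseqv :=
          { refl x := ⟨0, SameCycle.refl _ _⟩
            symm := fun ⟨k, hk⟩ =>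
              ⟨-k, by simpa [← Perm.mul_apply, ← zpow_add] using (sameCycle_zpow (-k) hk).symm⟩
            trans := fun ⟨k, hk⟩ ⟨l, hl⟩ =>
              ⟨l + k, by
                rw [zpow_add, Perm.mul_apply]
                exact (sameCycle_zpow l hk).trans hl⟩ } }
    exact (jointSetoid_le_iff (s := s)).2
      ⟨fun x => ⟨0, 1, by simp⟩, fun x => ⟨1, SameCycle.refl _ _⟩⟩ hxy
  · rintro ⟨k, hk⟩
    have rel_zpow : jointSetoid σ g x ((g ^ k) x) :=
      (le_sup_right : SameCycle.setoid g ≤ jointSetoid σ g) ⟨k, rfl⟩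
    exact Setoid.trans' _ rel_zpow ((le_sup_left : SameCycle.setoid σ ≤ jointSetoid σ g) hk)

end Orbits

section Twist

/-- The underlying set of the cycle of `π` through `x`. -/
def cycleSet {α : Type*} [Fintype α] [DecidableEq α] (π : Perm α) (x : α) : Finset α :=
  Finset.univ.filter fun y => π.SameCycle x y

section CycleSet

variable {α : Type*} [Fintype α] [DecidableEq α] {σ g : Perm α} {x y : α}

theorem mem_cycleSet : y ∈ cycleSet σ x ↔ σ.SameCycle x y := by
  simp [cycleSet]

theorem cycleSet_eq_iff : cycleSet σ x = cycleSet σ y ↔ σ.SameCycle x y := by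
  refine ⟨fun h => ?_, fun h => ?_⟩
  · rw [← mem_cycleSet, h, mem_cycleSet]
  · ext z
    rw [mem_cycleSet, mem_cycleSet]
    exact ⟨h.symm.trans, h.trans⟩

theorem smul_cycleSet (h : Commute σ g) (x : α) : g • cycleSet σ x = cycleSet σ (g x) := by
  ext y
  rw [← Finset.inv_smul_mem_iff, mem_cycleSet, mem_cycleSet, Perm.smul_def]
  conv_rhs => rw [← h.symm.mul_inv_cancel, sameCycle_conj]
  simp

end CycleSet

variable {n : ℕ}

theorem mem_cyclesOfLength {σ : Perm (Fin n)} {i : ℕ} {c : Finset (Fin n)} :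
    c ∈ cyclesOfLength σ i ↔ (∃ x, cycleSet σ x = c) ∧ c.card = i := by
  simp [cyclesOfLength, cycleSet]

theorem card_cycleSet_mem_Icc (σ : Perm (Fin n)) (x : Fin n) :
    (cycleSet σ x).card ∈ Finset.Icc 1 n := by
  rw [Finset.mem_Icc, Finset.one_le_card]
  exact ⟨⟨x, mem_cycleSet.2 (SameCycle.refl _ _)⟩, by simpa using (cycleSet σ x).card_le_univ⟩

theorem commute_coe_centralizer {G : Type*} [Group G] {s : G} (z : Subgroup.centralizer {s}) :
    Commute s z :=
  (Subgroup.mem_centralizer_singleton_iff.1 z.2).symm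

theorem cycleAction_zpow_apply (σ : Perm (Fin n)) (z : Subgroup.centralizer {σ}) (i : ℕ) (k : ℤ)
    (c : {c // c ∈ cyclesOfLength σ i}) :
    ((cycleAction σ i z ^ k) c : Finset (Fin n)) =
      (z : Perm (Fin n)) ^ k • (c : Finset (Fin n)) := by
  rw [← map_zpow]
  rfl

theorem sum_card_quotient_cycleAction (σ : Perm (Fin n)) (z : Subgroup.centralizer {σ}) :
    ∑ i ∈ Finset.Icc 1 n, Nat.card (Quotient (SameCycle.setoid (cycleAction σ i z))) =
      jointOrbits σ z := by
  have commute_zpow (k : ℤ) : Commute σ ((z : Perm (Fin n)) ^ k) :=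
    (commute_coe_centralizer z).zpow_right k
  have card_cycleSet_congr (x y : Fin n) (h : jointSetoid σ z x y) :
      (cycleSet σ x).card = (cycleSet σ y).card := by
    obtain ⟨k, hk⟩ := (jointSetoid_iff_of_commute (commute_coe_centralizer z)).1 h
    rw [← cycleSet_eq_iff.2 hk, ← smul_cycleSet (commute_zpow k), Finset.card_smul_finset]
  rw [jointOrbits, card_quotient_eq_sum_fiberwise _ (fun x => (cycleSet σ x).card) _
    (card_cycleSet_mem_Icc σ) card_cycleSet_congr]
  refine Finset.sum_congr rfl fun i _ => Eq.symm <| card_quotient_congr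
    (fun x => ⟨cycleSet σ x.1, mem_cyclesOfLength.2 ⟨⟨x.1, rfl⟩, x.2⟩⟩) ?_ fun x y => ?_
  · rintro ⟨c, hc⟩
    obtain ⟨⟨x, rfl⟩, hx⟩ := mem_cyclesOfLength.1 hc
    exact ⟨⟨x, hx⟩, rfl⟩
  · refine (jointSetoid_iff_of_commute (commute_coe_centralizer z)).trans (exists_congr fun k => ?_)
    rw [Subtype.ext_iff, cycleAction_zpow_apply, smul_cycleSet (commute_zpow k), cycleSet_eq_iff]

/-- The twisting character of the centraliser of `σ` at `g`, in a form that makes sense for all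
pairs of permutations; see `twistSign_apply`. -/
def twist {α : Type*} [Fintype α] [DecidableEq α] (σ g : Perm α) : ℤˣ :=
  sign σ * (-1) ^ (Fintype.card α + jointOrbits σ g)

theorem twist_conj {α : Type*} [Fintype α] [DecidableEq α] (σ g x : Perm α) :
    twist (x * σ * x⁻¹) (x * g * x⁻¹) = twist σ g := by
  rw [twist, twist, jointOrbits_conj, Perm.sign_mul, Perm.sign_mul, Perm.sign_inv,
    mul_right_comm (sign x), Int.units_mul_self, one_mul]

theorem twistSign_apply (σ : Perm (Fin n)) (z : Subgroup.centralizer {σ}) :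
    twistSign σ z = twist σ z := by
  have twistSign_eq (w : Subgroup.centralizer {σ}) : twistSign σ w =
      (-1) ^ (∑ i ∈ Finset.Icc 1 n, Fintype.card {c // c ∈ cyclesOfLength σ i}) *
        (-1) ^ jointOrbits σ w := by
    simp only [twistSign, MonoidHom.finsetProd_apply, MonoidHom.comp_apply,
      sign_eq_neg_one_pow_card_quotient, pow_add, Finset.prod_mul_distrib,
      Finset.prod_pow_eq_pow_sum, sum_card_quotient_cycleAction]
  -- The number of cycles of `σ` is read off from `twistSign σ 1 = 1`.
  have twistSign_one := twistSign_eq 1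
  rw [map_one, Subgroup.coe_one, jointOrbits_one, ← mul_inv_eq_iff_eq_mul, one_mul] at twistSign_one
  rw [twistSign_eq, ← twistSign_one, twist, sign_eq_neg_one_pow_card_quotient σ, pow_add, pow_add,
    Int.units_inv_eq_self, mul_mul_mul_comm, Int.units_mul_self, one_mul]

end Twist

section ConjugacyClasses

theorem sum_conj_eq_card_centralizer_smul {G M : Type*} [Group G] [Fintype G] [AddCommMonoid M]
    [DecidableRel (IsConj (α := G))] (s : G) (F : G → M) :
    ∑ x, F (x⁻¹ * s * x) = Nat.card (Subgroup.centralizer {s}) • ∑ t with IsConj s t, F t := by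
  classical
  rw [← Finset.sum_fiberwise_of_maps_to (t := Finset.univ.filter (IsConj s))
    (g := fun x => x⁻¹ * s * x) (fun x _ => Finset.mem_filter.2
      ⟨Finset.mem_univ _, isConj_iff.2 ⟨x⁻¹, by rw [inv_inv]⟩⟩), Finset.smul_sum]
  refine Finset.sum_congr rfl fun t ht => ?_
  obtain ⟨y, rfl⟩ := isConj_iff.1 (Finset.mem_filter.1 ht).2
  rw [Finset.sum_congr rfl fun x hx => by rw [(Finset.mem_filter.1 hx).2], Finset.sum_const]
  congr 1
  rw [← Fintype.card_subtype, ← Nat.card_eq_fintype_card]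
  refine Nat.card_congr ((Equiv.mulRight y).subtypeEquiv fun x => ?_)
  rw [Equiv.coe_mulRight, Subgroup.mem_centralizer_singleton_iff, mul_assoc x⁻¹,
    inv_mul_eq_iff_eq_mul, ← mul_right_cancel_iff (a := y)]
  simp only [mul_assoc, inv_mul_cancel, mul_one]
  exact eq_comm

theorem card_centralizer_congr {G : Type*} [Group G] {s t : G} (h : IsConj s t) :
    Nat.card (Subgroup.centralizer {s}) = Nat.card (Subgroup.centralizer {t}) := by
  obtain ⟨x, rfl⟩ := isConj_iff.1 h
  refine Nat.card_congr ((MulAut.conj x).toEquiv.subtypeEquiv fun z => ?_)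
  simp only [Subgroup.mem_centralizer_singleton_iff, MulEquiv.toEquiv_eq_coe, EquivLike.coe_coe,
    MulAut.conj_apply]
  rw [conj_mul, conj_mul, mul_left_inj, mul_right_inj]

/-- The cycle type of a permutation of `Fin n`, fixed points included, as a partition of `n`. -/
def cycleShape {n : ℕ} (σ : Perm (Fin n)) : n.Partition :=
  ⟨σ.partition.parts, σ.partition.parts_pos, by rw [σ.partition.parts_sum, Fintype.card_fin]⟩

variable {n : ℕ} {σ τ : Perm (Fin n)} {l : n.Partition}

theorem cycleShape_rep (l : n.Partition) : cycleShape (rep l) = l :=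
  Nat.Partition.ext (rep_hasType l)

theorem isConj_iff_cycleShape_eq : IsConj σ τ ↔ cycleShape σ = cycleShape τ := by
  rw [partition_eq_of_isConj, Nat.Partition.ext_iff, Nat.Partition.ext_iff]
  rfl

theorem isConj_rep_iff : IsConj (rep l) σ ↔ cycleShape σ = l := by
  rw [isConj_iff_cycleShape_eq, cycleShape_rep, eq_comm]

theorem cycleShape_inv (σ : Perm (Fin n)) : cycleShape σ⁻¹ = cycleShape σ :=
  isConj_iff_cycleShape_eq.1 (isConj_iff_cycleType_eq.2 (cycleType_inv σ))

theorem cycleShape_one : (cycleShape (1 : Perm (Fin n))).parts = Multiset.replicate n 1 := by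
  change (1 : Perm (Fin n)).partition.parts = _
  simp [parts_partition]

theorem sum_conj_rep {M : Type*} [AddCommMonoid M] (l : n.Partition) (F : Perm (Fin n) → M) :
    ∑ x, F (x⁻¹ * rep l * x) =
      Nat.card (Subgroup.centralizer {rep l}) • ∑ t with cycleShape t = l, F t := by
  classical
  rw [sum_conj_eq_card_centralizer_smul]
  simp only [isConj_rep_iff]

theorem card_centralizer_mul_card_cycleShape_eq (l : n.Partition) :
    Nat.card (Subgroup.centralizer {rep l}) *
      (Finset.univ.filter fun σ => cycleShape σ = l).card = n.factorial := by
  simpa [Fintype.card_perm] using (sum_conj_rep l fun _ => (1 : ℕ)).symm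

end ConjugacyClasses

section OddParts

variable {n : ℕ} {g : Perm (Fin n)}

theorem mem_odds_iff {l : n.Partition} : l ∈ Nat.Partition.odds n ↔ ∀ i ∈ l.parts, Odd i := by
  simp [Nat.Partition.odds, Nat.Partition.restricted]

theorem cycleShape_one_mem_odds : cycleShape (1 : Perm (Fin n)) ∈ Nat.Partition.odds n := by
  rw [mem_odds_iff, cycleShape_one]
  exact fun i hi => Multiset.eq_of_mem_replicate hi ▸ odd_one

theorem odd_orderOf (hg : cycleShape g ∈ Nat.Partition.odds n) : Odd (orderOf g) := by
  rw [← Nat.not_even_iff_odd, even_iff_two_dvd]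
  intro two_dvd
  have dvd_prod : orderOf g ∣ g.cycleType.prod :=
    lcm_cycleType g ▸ Multiset.lcm_dvd.2 fun i hi => Multiset.dvd_prod hi
  obtain ⟨i, hi, two_dvd_i⟩ :=
    Nat.prime_two.prime.exists_mem_multiset_dvd (two_dvd.trans dvd_prod)
  exact Nat.not_even_iff_odd.2 (mem_odds_iff.1 hg i (Multiset.mem_add.2 (.inl hi)))
    (even_iff_two_dvd.2 two_dvd_i)

theorem monoidHom_intUnits_eq_one_of_odd_orderOf {G : Type*} [Group G] (χ : G →* ℤˣ) {x : G}
    (hx : Odd (orderOf x)) : χ x = 1 := by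
  rcases Int.units_eq_one_or (χ x) with h | h
  · exact h
  · have pow_eq : χ x ^ orderOf x = 1 := by rw [← map_pow, pow_orderOf_eq_one, map_one]
    rw [h, hx.neg_one_pow] at pow_eq
    exact absurd pow_eq (by decide)

theorem twist_eq_one_of_mem_odds {σ : Perm (Fin n)} (hg : cycleShape g ∈ Nat.Partition.odds n)
    (h : Commute σ g) : twist σ g = 1 := by
  rw [← twistSign_apply σ ⟨g, Subgroup.mem_centralizer_singleton_iff.2 h.symm.eq⟩]
  refine monoidHom_intUnits_eq_one_of_odd_orderOf _ ?_
  rw [← Subgroup.orderOf_coe]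
  exact odd_orderOf hg

theorem exists_even_cycleFactor (hg : cycleShape g ∉ Nat.Partition.odds n) :
    ∃ γ ∈ g.cycleFactorsFinset, Even γ.support.card := by
  simp only [mem_odds_iff, not_forall, Nat.not_odd_iff_even] at hg
  obtain ⟨i, hi, even_i⟩ := hg
  rcases Multiset.mem_add.1 hi with hi | hi
  · rw [cycleType_def, Multiset.mem_map] at hi
    obtain ⟨γ, hγ, rfl⟩ := hi
    exact ⟨γ, hγ, even_i⟩
  · rw [Multiset.eq_of_mem_replicate hi] at even_i
    exact absurd even_i (by decide)

theorem twist_mul_cycleFactor (σ : Perm (Fin n)) {γ : Perm (Fin n)}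
    (hγ : γ ∈ g.cycleFactorsFinset) (even_γ : Even γ.support.card) :
    twist (σ * γ) g = -twist σ g := by
  have isCycle_and_apply := mem_cycleFactorsFinset_iff.1 hγ
  have setoid_le : SameCycle.setoid γ ≤ SameCycle.setoid g := sameCycle_setoid_le_iff.2 fun x => by
    by_cases hx : x ∈ γ.support
    · exact ⟨1, (isCycle_and_apply.2 x hx).symm⟩
    · rw [notMem_support.1 hx]
  rw [twist, twist, jointOrbits_mul_left setoid_le, Perm.sign_mul, isCycle_and_apply.1.sign,
    even_γ.neg_one_pow, mul_neg_one, neg_mul]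

end OddParts

section TwistedConjCharacter

theorem character_ind_subtype {k G : Type*} [Field k] [CharZero k] [Group G] [Fintype G]
    (H : Subgroup G) [DecidablePred (· ∈ H)] {A : Type*} [AddCommGroup A] [Module k A]
    [FiniteDimensional k A] (ρ : Representation k H A) (g : G) :
    (ind H.subtype ρ).character g = (Nat.card H : k)⁻¹ *
      ∑ x : G, if h : x * g * x⁻¹ ∈ H then ρ.character ⟨x * g * x⁻¹, h⟩ else 0 := by
  classical
  have : Invertible (Fintype.card H : k) :=
    invertibleOfNonzero (Nat.cast_ne_zero.2 Fintype.card_ne_zero)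
  rw [character_ind, Nat.card_eq_fintype_card]
  congr 1
  simp_rw [Fintype.card_subtype, Finset.natCast_card_filter, Finset.mul_sum]
  rw [Finset.sum_comm]
  refine Finset.sum_congr rfl fun x _ => ?_
  have intertwines_iff (h : H) : H.subtype h * x = x * g ↔ (h : G) = x * g * x⁻¹ := by
    rw [eq_mul_inv_iff_mul_eq, Subgroup.subtype_apply]
  simp_rw [intertwines_iff, mul_ite, mul_one, mul_zero]
  split_ifs with hx
  · rw [Finset.sum_eq_single_of_mem ⟨x * g * x⁻¹, hx⟩ (Finset.mem_univ _)
      fun h _ hne => if_neg fun he => hne (Subtype.ext he), if_pos rfl]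
  · exact Finset.sum_eq_zero fun h _ => if_neg fun he => hx (he.subst (motive := (· ∈ H)) h.2)

instance finite_indV {k G : Type*} [Field k] [Group G] [Finite G] (H : Subgroup G) {A : Type*}
    [AddCommGroup A] [Module k A] [FiniteDimensional k A] (ρ : Representation k H A) :
    FiniteDimensional k (IndV H.subtype ρ) := by
  have : Module.Finite k (MonoidAlgebra k G) :=
    Module.Finite.equiv (MonoidAlgebra.coeffLinearEquiv k).symm
  infer_instance

theorem character_linRep {G : Type} [Group G] (χ : G →* ℤˣ) (g : G) :
    (linRep χ).character g = ((χ g : ℤ) : ℂ) := by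
  simp [character, linRep]

variable {n : ℕ}

theorem character_twistedClass (l : n.Partition) (g : Perm (Fin n)) :
    (twistedClass l).character g =
      ∑ σ with cycleShape σ = l, if σ * g = g * σ then ((twist σ g : ℤ) : ℂ) else 0 := by
  classical
  rw [character_ind_subtype, inv_mul_eq_iff_eq_mul₀ (Nat.cast_ne_zero.2 Nat.card_pos.ne'),
    ← nsmul_eq_mul, ← sum_conj_rep]
  refine Finset.sum_congr rfl fun x _ => ?_
  have commute_iff : x⁻¹ * rep l * x * g = g * (x⁻¹ * rep l * x) ↔
      x * g * x⁻¹ ∈ Subgroup.centralizer {rep l} := by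
    rw [Subgroup.mem_centralizer_singleton_iff, ← mul_left_cancel_iff (a := x),
      ← mul_right_cancel_iff (a := x⁻¹)]
    simp only [mul_assoc, mul_inv_cancel_left, mul_inv_cancel, mul_one]
    exact eq_comm
  simp only [commute_iff]
  split_ifs with hx
  · rw [character_linRep, twistSign_apply, ← twist_conj (x⁻¹ * rep l * x) g x]
    simp only [mul_assoc, mul_inv_cancel_left, mul_inv_cancel, mul_one]
  · rfl

theorem character_twistedConj_eq_sum (g : Perm (Fin n)) :
    (twistedConj n).character g =
      ∑ σ, if σ * g = g * σ then ((twist σ g : ℤ) : ℂ) else 0 := by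
  rw [character_directSum]
  simp only [character_twistedClass]
  exact Finset.sum_fiberwise Finset.univ cycleShape _

theorem character_twistedConj_of_mem_odds {g : Perm (Fin n)}
    (hg : cycleShape g ∈ Nat.Partition.odds n) :
    (twistedConj n).character g = Nat.card (Subgroup.centralizer {g}) := by
  rw [character_twistedConj_eq_sum, Nat.subtype_card (Finset.univ.filter fun σ => σ * g = g * σ)
    fun σ => by simp [Subgroup.mem_centralizer_singleton_iff], Finset.natCast_card_filter]
  refine Finset.sum_congr rfl fun σ _ => if_ctx_congr Iff.rfl (fun h => ?_) fun _ => rfl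
  rw [twist_eq_one_of_mem_odds hg h, Units.val_one, Int.cast_one]

theorem character_twistedConj_of_notMem_odds {g : Perm (Fin n)}
    (hg : cycleShape g ∉ Nat.Partition.odds n) : (twistedConj n).character g = 0 := by
  obtain ⟨γ, hγ, even_γ⟩ := exists_even_cycleFactor hg
  have commute_γ : γ * g = g * γ := (self_mem_cycle_factors_commute hγ).eq
  -- Right translation by `γ` permutes the centraliser of `g` and flips every twist.
  refine self_eq_neg.1 ?_
  simp only [character_twistedConj_eq_sum]
  rw [← Finset.sum_neg_distrib, ← Equiv.sum_comp (Equiv.mulRight γ)]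
  refine Finset.sum_congr rfl fun σ _ => ?_
  have commute_iff : σ * γ * g = g * (σ * γ) ↔ σ * g = g * σ := by
    rw [mul_assoc, commute_γ, ← mul_assoc, ← mul_assoc, mul_left_inj]
  simp only [Equiv.coe_mulRight, commute_iff, twist_mul_cycleFactor σ hγ even_γ]
  split_ifs <;> simp

theorem sum_character_twistedConj_smul {M : Type*} [AddCommGroup M] [Module ℂ M]
    (Φ : n.Partition → M) :
    (n.factorial : ℂ)⁻¹ • ∑ g : Perm (Fin n), (twistedConj n).character g • Φ (cycleShape g) =
      ∑ l ∈ Nat.Partition.odds n, Φ l := by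
  rw [inv_smul_eq_iff₀ (Nat.cast_ne_zero.2 n.factorial_ne_zero),
    ← Finset.sum_fiberwise Finset.univ cycleShape, Finset.smul_sum,
    ← Finset.sum_subset (Finset.subset_univ (Nat.Partition.odds n)) fun l _ hl =>
      Finset.sum_eq_zero fun g hg => ?_]
  · refine Finset.sum_congr rfl fun l hl => ?_
    rw [← card_centralizer_mul_card_cycleShape_eq l, mul_comm, Nat.cast_mul, mul_smul,
      Nat.cast_smul_eq_nsmul, ← Finset.sum_const]
    refine Finset.sum_congr rfl fun g hg => ?_
    have cycleShape_g := (Finset.mem_filter.1 hg).2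
    rw [character_twistedConj_of_mem_odds (cycleShape_g ▸ hl), cycleShape_g,
      card_centralizer_congr (isConj_rep_iff.2 cycleShape_g)]
  · rw [← (Finset.mem_filter.1 hg).2] at hl
    exact smul_eq_zero_of_left (character_twistedConj_of_notMem_odds hl) _

theorem frob_twistedConj (n : ℕ) : frob (twistedConj n) = ∑ l ∈ Nat.Partition.odds n, pPart l :=
  sum_character_twistedConj_smul pPart

instance finiteDimensional_twistedSpace (n : ℕ) : FiniteDimensional ℂ (TwistedSpace n) :=
  Module.Finite.equiv (DirectSum.linearEquivFunOnFintype ℂ n.Partition _).symm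

theorem finrank_twistedSpace (n : ℕ) : Module.finrank ℂ (TwistedSpace n) = n.factorial := by
  have centralizer_one : Subgroup.centralizer {(1 : Perm (Fin n))} = ⊤ := by
    ext; simp [Subgroup.mem_centralizer_singleton_iff]
  have char_one := (twistedConj n).char_one
  rw [character_twistedConj_of_mem_odds cycleShape_one_mem_odds, centralizer_one,
    Subgroup.card_top, Nat.card_eq_fintype_card, Fintype.card_perm, Fintype.card_fin] at char_one
  exact_mod_cast char_one.symm

theorem nonempty_twistedConj_tprod_sgnRep_equiv (n : ℕ) :
    Nonempty (((twistedConj n).tprod (sgnRep n)).Equiv (twistedConj n)) := by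
  refine nonempty_equiv_of_character_eq _ _ (funext fun g => ?_)
  rw [char_tensor, Pi.mul_apply, character_linRep]
  by_cases hg : cycleShape g ∈ Nat.Partition.odds n
  · rw [monoidHom_intUnits_eq_one_of_odd_orderOf sign (odd_orderOf hg), Units.val_one,
      Int.cast_one, mul_one]
  · rw [character_twistedConj_of_notMem_odds hg, zero_mul]

theorem exists_natCast_eq_sum_irrChar (ν : n.Partition) :
    ∃ k : ℕ, ∑ l ∈ Nat.Partition.odds n, irrChar ν l = (k : ℂ) := by
  have : Module.Finite ℂ (MonoidAlgebra ℂ (Perm (Fin n))) :=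
    Module.Finite.equiv (MonoidAlgebra.coeffLinearEquiv ℂ).symm
  have : FiniteDimensional ℂ
      ↥(Ideal.span {youngSymmetrizer ν} : Ideal (MonoidAlgebra ℂ (Perm (Fin n)))) :=
    finite_submodule_of_isScalarTower _
  have : Invertible (Nat.card (Perm (Fin n)) : ℂ) :=
    invertibleOfNonzero (Nat.cast_ne_zero.2 Nat.card_pos.ne')
  refine ⟨_, Eq.trans ?_
    (card_inv_mul_sum_char_mul_char_eq_finrank (specht ν) (twistedConj n))⟩
  rw [← sum_character_twistedConj_smul, Nat.card_eq_fintype_card, Fintype.card_perm,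
    Fintype.card_fin, smul_eq_mul]
  refine congrArg _ (Finset.sum_congr rfl fun g _ => ?_)
  obtain ⟨x, hx⟩ := isConj_iff.1 (isConj_rep_iff.2 (cycleShape_inv g))
  rw [smul_eq_mul, irrChar, ← hx, char_conj]

end TwistedConjCharacter

section LogarithmicDerivative

open Filter PowerSeries
open Finset.HasAntidiagonal (antidiagonal)
open scoped PowerSeries.WithPiTopology

variable {A : Type*} [CommRing A]

/-- The power series `E` has constant coefficient `1` and logarithmic derivative `L`. The condition
is stated as `E' = L * E`, which avoids inverting `E`. -/
structure HasLogDeriv (E L : A⟦X⟧) : Prop where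
  constantCoeff_eq_one : constantCoeff E = 1
  derivative_eq : d⁄dX A E = L * E

theorem derivative_map {B : Type*} [CommRing B] (f : A →+* B) (E : A⟦X⟧) :
    d⁄dX B (E.map f) = (d⁄dX A E).map f := by
  ext n
  simp only [coeff_derivative, coeff_map, map_mul, map_add, map_natCast, map_one]

namespace HasLogDeriv

theorem coeff_succ_mul {E L : A⟦X⟧} (h : HasLogDeriv E L) (n : ℕ) :
    coeff (n + 1) E * (n + 1) = ∑ x ∈ antidiagonal n, coeff x.1 L * coeff x.2 E := by
  rw [← coeff_derivative, h.derivative_eq, coeff_mul]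

theorem unique [IsAddTorsionFree A] {E F L : A⟦X⟧} (hE : HasLogDeriv E L) (hF : HasLogDeriv F L) :
    E = F := by
  ext n
  induction n using Nat.strong_induction_on with
  | _ n ih =>
    cases n with
    | zero =>
      rw [coeff_zero_eq_constantCoeff_apply, coeff_zero_eq_constantCoeff_apply,
        hE.constantCoeff_eq_one, hF.constantCoeff_eq_one]
    | succ n =>
      refine nsmul_right_injective n.succ_ne_zero ?_
      simp only [nsmul_eq_mul, Nat.cast_succ, mul_comm _ (coeff (n + 1) _), coeff_succ_mul hE,
        coeff_succ_mul hF]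
      exact Finset.sum_congr rfl fun x hx => by
        rw [ih x.2 (Finset.Nat.antidiagonal.snd_lt hx)]

theorem coeff_mem {K : Type*} [Field K] [CharZero K] [Algebra K A] {E L : A⟦X⟧}
    (h : HasLogDeriv E L) (S : Subalgebra K A) {n : ℕ} (hL : ∀ k < n, coeff k L ∈ S) :
    coeff n E ∈ S := by
  induction n using Nat.strong_induction_on with
  | _ n ih =>
    cases n with
    | zero =>
      rw [coeff_zero_eq_constantCoeff_apply, h.constantCoeff_eq_one]
      exact S.one_mem
    | succ n =>
      have hmem : (n + 1 : K) • coeff (n + 1) E ∈ S := by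
        rw [Algebra.smul_def, map_add, map_natCast, map_one, mul_comm, h.coeff_succ_mul]
        refine S.sum_mem fun x hx => S.mul_mem
          (hL _ (Finset.Nat.antidiagonal.fst_lt hx)) ?_
        have hlt := Finset.Nat.antidiagonal.snd_lt hx
        exact ih x.2 hlt fun k hk => hL k (hk.trans hlt)
      have := S.smul_mem hmem (n + 1 : K)⁻¹
      rwa [inv_smul_smul₀ n.cast_add_one_ne_zero] at this

theorem map {B : Type*} [CommRing B] {E L : A⟦X⟧} (h : HasLogDeriv E L) (f : A →+* B) :
    HasLogDeriv (E.map f) (L.map f) where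
  constantCoeff_eq_one := by
    rw [← coeff_zero_eq_constantCoeff_apply, coeff_map, coeff_zero_eq_constantCoeff_apply,
      h.constantCoeff_eq_one, map_one]
  derivative_eq := by rw [derivative_map, h.derivative_eq, map_mul]

theorem of_map {ι : Type*} {B : ι → Type*} [∀ i, CommRing (B i)] (f : ∀ i, A →+* B i)
    (hf : ∀ a b, (∀ i, f i a = f i b) → a = b) {E L : A⟦X⟧}
    (h : ∀ i, HasLogDeriv (E.map (f i)) (L.map (f i))) : HasLogDeriv E L where
  constantCoeff_eq_one := hf _ _ fun i => by
    rw [map_one, ← (h i).constantCoeff_eq_one, ← coeff_zero_eq_constantCoeff_apply,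
      ← coeff_zero_eq_constantCoeff_apply, coeff_map]
  derivative_eq := by
    ext n
    refine hf _ _ fun i => ?_
    rw [← coeff_map, ← coeff_map, ← derivative_map, (h i).derivative_eq,
      map_mul (PowerSeries.map (f i))]

theorem one : HasLogDeriv (1 : A⟦X⟧) 0 :=
  ⟨map_one _, by rw [derivative_one, zero_mul]⟩

theorem mul {E F L M : A⟦X⟧} (hE : HasLogDeriv E L) (hF : HasLogDeriv F M) :
    HasLogDeriv (E * F) (L + M) where
  constantCoeff_eq_one := by
    rw [map_mul, hE.constantCoeff_eq_one, hF.constantCoeff_eq_one, one_mul]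
  derivative_eq := by
    rw [Derivation.leibniz, hE.derivative_eq, hF.derivative_eq, smul_eq_mul, smul_eq_mul]
    ring

theorem prod {ι : Type*} {E L : ι → A⟦X⟧} (h : ∀ i, HasLogDeriv (E i) (L i)) (s : Finset ι) :
    HasLogDeriv (∏ i ∈ s, E i) (∑ i ∈ s, L i) := by
  classical
  induction s using Finset.induction_on with
  | empty => exact one
  | insert i s hi ih =>
    rw [Finset.prod_insert hi, Finset.sum_insert hi]
    exact (h i).mul ih

theorem expand {E L : A⟦X⟧} (h : HasLogDeriv E L) {i : ℕ} (hi : i ≠ 0) :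
    HasLogDeriv (E.expand i hi) ((i : A⟦X⟧) * X ^ (i - 1) * L.expand i hi) where
  constantCoeff_eq_one := by rw [constantCoeff_expand, h.constantCoeff_eq_one]
  derivative_eq := by
    rw [expand_apply i hi E, derivative_subst (HasSubst.X_pow hi), ← expand_apply i hi,
      ← expand_apply i hi, h.derivative_eq, map_mul, derivative_pow, derivative_X]
    ring

theorem hasProd [TopologicalSpace A] [IsTopologicalRing A] [T2Space A] {ι : Type*}
    {E L : ι → A⟦X⟧} {F M : A⟦X⟧} (h : ∀ i, HasLogDeriv (E i) (L i)) (hE : HasProd E F)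
    (hL : HasSum L M) : HasLogDeriv F M := by
  have hconst : Tendsto (fun s => constantCoeff (∏ i ∈ s, E i)) atTop (nhds (constantCoeff F)) :=
    ((WithPiTopology.continuous_constantCoeff A).tendsto F).comp hE
  have hderiv : Tendsto (fun s => d⁄dX A (∏ i ∈ s, E i)) atTop (nhds (d⁄dX A F)) := by
    rw [WithPiTopology.tendsto_iff_coeff_tendsto]
    intro m
    simp only [coeff_derivative]
    exact (((WithPiTopology.continuous_coeff A (m + 1)).tendsto F).comp hE).mul_const _
  simp only [(prod h _).constantCoeff_eq_one] at hconst
  simp only [(prod h _).derivative_eq] at hderiv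
  exact ⟨tendsto_nhds_unique hconst tendsto_const_nhds,
    tendsto_nhds_unique hderiv (Tendsto.mul hL hE)⟩

end HasLogDeriv

end LogarithmicDerivative

section PowerSums

open MvPolynomial

variable (σ : Type*) [Fintype σ]

theorem hasLogDeriv_esymm (R : Type*) [CommRing R] :
    HasLogDeriv (PowerSeries.mk fun k => esymm σ R k)
      (PowerSeries.mk fun j => (-1) ^ j * psum σ R (j + 1)) where
  constantCoeff_eq_one := by
    rw [← PowerSeries.coeff_zero_eq_constantCoeff_apply, PowerSeries.coeff_mk, esymm_zero]
  derivative_eq := by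
    ext1 n
    have hnewton := mul_esymm_eq_sum σ R (n + 1)
    rw [Finset.sum_filter, Finset.Nat.sum_antidiagonal_succ', if_neg (lt_irrefl _), zero_add,
      Finset.mul_sum, Nat.cast_succ] at hnewton
    rw [PowerSeries.coeff_derivative, PowerSeries.coeff_mul, PowerSeries.coeff_mk, mul_comm,
      hnewton, ← Finset.Nat.sum_antidiagonal_swap]
    refine Finset.sum_congr rfl fun x hx => ?_
    obtain ⟨a, b⟩ := x
    obtain rfl : a + b = n := Finset.HasAntidiagonal.mem_antidiagonal.1 hx
    have hsign : (-1 : MvPolynomial σ R) ^ (a + b + 1 + 1) * (-1) ^ b = (-1) ^ a := by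
      rw [← pow_add, show a + b + 1 + 1 + b = a + 2 * (b + 1) by ring, pow_add, pow_mul]
      simp
    rw [Prod.swap, if_pos (by lia), PowerSeries.coeff_mk, PowerSeries.coeff_mk, ← hsign]
    ring

variable (K : Type*) [Field K] [CharZero K]

theorem esymm_mem_adjoin_psum {k : ℕ} (hk : k ≤ Fintype.card σ) :
    esymm σ K k ∈
      Algebra.adjoin K (Set.range fun j : Fin (Fintype.card σ) => psum σ K (j + 1)) := by
  have hmem := (hasLogDeriv_esymm σ K).coeff_mem
    (Algebra.adjoin K (Set.range fun j : Fin (Fintype.card σ) => psum σ K (j + 1))) (n := k)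
    fun j hj => ?_
  · rwa [PowerSeries.coeff_mk] at hmem
  · rw [PowerSeries.coeff_mk]
    exact mul_mem (pow_mem (neg_mem (one_mem _)) _)
      (Algebra.subset_adjoin ⟨⟨j, hj.trans_le hk⟩, rfl⟩)

theorem isAlgebraic_adjoin_psum : Algebra.IsAlgebraic
    (Algebra.adjoin K (Set.range fun j : Fin (Fintype.card σ) => psum σ K (j + 1)))
    (MvPolynomial σ K) := by
  set S := Algebra.adjoin K (Set.range fun j : Fin (Fintype.card σ) => psum σ K (j + 1))
  have hlifts : ∏ i : σ, (Polynomial.X + Polynomial.C (X i : MvPolynomial σ K)) ∈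
      Polynomial.lifts (algebraMap S (MvPolynomial σ K)) := by
    rw [prod_C_add_X_eq_sum_esymm]
    refine sum_mem fun j hj => mul_mem (Polynomial.C'_mem_lifts ?_)
      (Polynomial.X_pow_mem_lifts _ _)
    exact ⟨⟨_, esymm_mem_adjoin_psum σ K (Nat.le_of_lt_succ (Finset.mem_range.1 hj))⟩, rfl⟩
  obtain ⟨q, hq, -, hmonic⟩ := Polynomial.lifts_and_natDegree_eq_and_monic hlifts
    (Polynomial.monic_prod_of_monic _ _ fun i _ => Polynomial.monic_X_add_C _)
  have hX (i : σ) : IsIntegral S (X i : MvPolynomial σ K) := by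
    rw [← neg_neg (X i)]
    refine IsIntegral.neg ⟨q, hmonic, ?_⟩
    rw [← Polynomial.eval_map, hq, Polynomial.eval_prod]
    exact Finset.prod_eq_zero (Finset.mem_univ i) (by simp)
  have htop : (integralClosure S (MvPolynomial σ K)).restrictScalars K = ⊤ := by
    rw [eq_top_iff, ← adjoin_range_X, Algebra.adjoin_le_iff]
    rintro _ ⟨i, rfl⟩
    exact hX i
  exact ⟨fun p => IsIntegral.isAlgebraic (htop ▸ Algebra.mem_top : p ∈ _)⟩

theorem algebraicIndependent_psum :
    AlgebraicIndependent K fun j : Fin (Fintype.card σ) => psum σ K (j + 1) := by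
  have := isAlgebraic_adjoin_psum σ K
  refine (Algebra.IsAlgebraic.isTranscendenceBasis_of_lift_le_trdeg_of_finite K _ ?_).1
  rw [MvPolynomial.trdeg_of_isDomain]
  simp

end PowerSums

section Restriction

open MvPolynomial

/-- The specialization `x_i ↦ 0` for `i ≥ N`. -/
abbrev restrictVars (N : ℕ) : MvPowerSeries ℕ ℂ →ₐ[ℂ] MvPowerSeries (Fin N) ℂ :=
  MvPowerSeries.killCompl Fin.valEmbedding

theorem eq_of_restrictVars_eq {f g : MvPowerSeries ℕ ℂ}
    (h : ∀ N, restrictVars N f = restrictVars N g) : f = g := by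
  ext m
  obtain ⟨N, hN⟩ := m.support.bddAbove
  obtain ⟨x, rfl⟩ : ∃ x : Fin (N + 1) →₀ ℕ, x.embDomain Fin.valEmbedding = m :=
    ⟨_, Finsupp.embDomain_comapDomain fun i hi => ⟨⟨i, Nat.lt_succ_of_le (hN hi)⟩, rfl⟩⟩
  simpa only [MvPowerSeries.coeff_killCompl] using
    congrArg (MvPowerSeries.coeff x) (h (N + 1))

theorem coeff_sum_monomial_one {σ ι R : Type*} [CommSemiring R] {s : Finset ι} {f : ι → σ →₀ ℕ}
    (hf : Set.InjOn f s) (x : σ →₀ ℕ) [Decidable (∃ i ∈ s, f i = x)] :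
    coeff x (∑ i ∈ s, monomial (f i) (1 : R)) = if ∃ i ∈ s, f i = x then 1 else 0 := by
  classical
  simp only [coeff_sum, coeff_monomial]
  split_ifs with h
  · obtain ⟨i, hi, rfl⟩ := h
    rw [Finset.sum_eq_single_of_mem i hi fun j hj hji => if_neg fun h => hji (hf hj hi h),
      if_pos rfl]
  · push Not at h
    exact Finset.sum_eq_zero fun i hi => if_neg (h i hi)

theorem coeff_pSym (k : ℕ) (m : ℕ →₀ ℕ) [Decidable (∃ i, m = Finsupp.single i k)] :
    MvPowerSeries.coeff m (pSym k) = if ∃ i, m = Finsupp.single i k then 1 else 0 := by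
  rw [MvPowerSeries.coeff_apply, pSym]
  congr

theorem coeff_eSym (k : ℕ) (m : ℕ →₀ ℕ) [Decidable ((∀ i, m i ≤ 1) ∧ m.degree = k)] :
    MvPowerSeries.coeff m (eSym k) = if (∀ i, m i ≤ 1) ∧ m.degree = k then 1 else 0 := by
  rw [MvPowerSeries.coeff_apply, eSym]
  congr

theorem embDomain_eq_single_iff {α β M : Type*} [Zero M] (e : α ↪ β) {x : α →₀ M} {a : M}
    (ha : a ≠ 0) :
    (∃ b, x.embDomain e = Finsupp.single b a) ↔ ∃ j, Finsupp.single j a = x := by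
  constructor
  · rintro ⟨b, hb⟩
    have hmem : b ∈ (x.embDomain e).support := by simp [hb, ha]
    obtain ⟨j, -, rfl⟩ := Finset.mem_map.1 (Finsupp.support_embDomain e x ▸ hmem)
    exact ⟨j, Finsupp.embDomain_injective e (by rw [hb, Finsupp.embDomain_single])⟩
  · rintro ⟨j, rfl⟩
    exact ⟨e j, Finsupp.embDomain_single _ _ _⟩

theorem restrictVars_pSym (N : ℕ) {k : ℕ} (hk : k ≠ 0) :
    restrictVars N (pSym k) = (psum (Fin N) ℂ k : MvPowerSeries (Fin N) ℂ) := by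
  classical
  ext x
  simp only [psum, X_pow_eq_monomial]
  rw [MvPowerSeries.coeff_killCompl, coeff_pSym, coeff_coe,
    coeff_sum_monomial_one (Finsupp.single_left_injective hk).injOn]
  exact if_congr (by simpa using embDomain_eq_single_iff Fin.valEmbedding hk) rfl rfl

theorem sum_single_one_eq_toFinsupp {σ : Type*} [DecidableEq σ] (t : Finset σ) :
    ∑ i ∈ t, Finsupp.single i 1 = Multiset.toFinsupp t.val := by
  ext i
  simp [Finsupp.finsetSum_apply, Finsupp.single_apply, Multiset.count_eq_of_nodup t.nodup]

theorem exists_sum_single_one_eq_iff {σ : Type*} [Fintype σ] {k : ℕ} {x : σ →₀ ℕ} :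
    (∃ t ∈ Finset.powersetCard k Finset.univ, ∑ i ∈ t, Finsupp.single i 1 = x) ↔
      (∀ i, x i ≤ 1) ∧ x.degree = k := by
  classical
  have hdegree : x.degree = x.toMultiset.card := (Finsupp.card_toMultiset x).symm
  simp only [sum_single_one_eq_toFinsupp, Finset.mem_powersetCard_univ, hdegree,
    ← Finsupp.count_toMultiset, ← Multiset.nodup_iff_count_le_one]
  constructor
  · rintro ⟨t, rfl, rfl⟩
    simpa using t.nodup
  · rintro ⟨hx, hk⟩
    exact ⟨⟨x.toMultiset, hx⟩, hk, Finsupp.toMultiset_toFinsupp x⟩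

theorem embDomain_le_iff {α β : Type*} (e : α ↪ β) {x : α →₀ ℕ} {c : ℕ} :
    (∀ b, x.embDomain e b ≤ c) ↔ ∀ a, x a ≤ c := by
  refine ⟨fun h a => by simpa only [Finsupp.embDomain_apply_self] using h (e a), fun h b => ?_⟩
  by_cases hb : b ∈ Set.range e
  · obtain ⟨a, rfl⟩ := hb
    rw [Finsupp.embDomain_apply_self]
    exact h a
  · rw [Finsupp.embDomain_of_notMem_range _ _ _ hb]
    exact c.zero_le

theorem degree_embDomain {α β : Type*} (e : α ↪ β) (x : α →₀ ℕ) :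
    (x.embDomain e).degree = x.degree := by
  simp only [Finsupp.degree_apply, Finsupp.support_embDomain, Finset.sum_map,
    Finsupp.embDomain_apply_self]

theorem restrictVars_eSym (N k : ℕ) :
    restrictVars N (eSym k) = (esymm (Fin N) ℂ k : MvPowerSeries (Fin N) ℂ) := by
  classical
  have hinj : Function.Injective fun t : Finset (Fin N) => ∑ i ∈ t, Finsupp.single i 1 :=
    fun s t h => by simpa [sum_single_one_eq_toFinsupp] using h
  ext x
  rw [MvPowerSeries.coeff_killCompl, coeff_eSym, coeff_coe, esymm_eq_sum_monomial,
    coeff_sum_monomial_one hinj.injOn]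
  exact if_congr (by
    rw [exists_sum_single_one_eq_iff, embDomain_le_iff, degree_embDomain]) rfl rfl

end Restriction

section Plethysm

open MvPolynomial

theorem hasLogDeriv_eSym :
    HasLogDeriv (PowerSeries.mk eSym) (PowerSeries.mk fun j => (-1) ^ j * pSym (j + 1)) := by
  refine .of_map (fun N => (restrictVars N).toRingHom)
    (fun _ _ => eq_of_restrictVars_eq) fun N => ?_
  convert (hasLogDeriv_esymm (Fin N) ℂ).map coeToMvPowerSeries.ringHom using 1 <;> ext1 j
  · simp [restrictVars_eSym]
  · rw [PowerSeries.coeff_map, PowerSeries.coeff_map, PowerSeries.coeff_mk, PowerSeries.coeff_mk]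
    simp only [map_mul, map_pow, map_neg, map_one]
    simp [restrictVars_pSym]

theorem algebraicIndependent_pSym : AlgebraicIndependent ℂ fun k : ℕ+ => pSym k := by
  refine algebraicIndependent_of_finite_type fun t ht => ?_
  obtain ⟨N, hN⟩ := ht.bddAbove
  have hpsum : AlgebraicIndependent ℂ
      fun j : Fin (Fintype.card (Fin N)) => (psum (Fin N) ℂ (j + 1) : MvPowerSeries (Fin N) ℂ) :=
    (algebraicIndependent_psum (Fin N) ℂ).map' (f := coeToMvPowerSeries.algHom ℂ)
      (coe_injective (Fin N) ℂ)
  refine .of_comp (restrictVars N) ?_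
  convert hpsum.comp (fun i : t => ⟨(i : ℕ+).natPred, ?_⟩) ?_ using 1
  · ext1 i
    simp [restrictVars_pSym]
  · rw [Fintype.card_fin, ← Nat.succ_le_iff, Nat.succ_eq_add_one, PNat.natPred_add_one]
    exact hN i.2
  · intro i j hij
    exact Subtype.ext (PNat.natPred_injective (congrArg Fin.val hij))

theorem exists_aeval_eq_eSym (k : ℕ) :
    ∃ P, aeval (R := ℂ) (fun k : ℕ+ => pSym k) P = eSym k := by
  have hmem := hasLogDeriv_eSym.coeff_mem (aeval (R := ℂ) fun k : ℕ+ => pSym k).range (n := k)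
    fun j _ => ⟨(-1) ^ j * X j.succPNat, by simp⟩
  rwa [PowerSeries.coeff_mk] at hmem

theorem plethysm_aeval (P : MvPolynomial ℕ+ ℂ) (g : MvPowerSeries ℕ ℂ) :
    plethysm (aeval (fun k : ℕ+ => pSym k) P) g =
      aeval (fun k : ℕ+ => MvPowerSeries.expand (k : ℕ) k.ne_zero g) P := by
  have h : ∃ Q, aeval (fun k : ℕ+ => pSym k) Q = aeval (fun k : ℕ+ => pSym k) P := ⟨P, rfl⟩
  rw [plethysm, dif_pos h, algebraicIndependent_pSym h.choose_spec]

theorem hasLogDeriv_plethysm (g : MvPowerSeries ℕ ℂ) :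
    HasLogDeriv (PowerSeries.mk fun k => plethysm (eSym k) g)
      (PowerSeries.mk fun j => (-1) ^ j * MvPowerSeries.expand (j + 1) j.succ_ne_zero g) := by
  choose P hP using exists_aeval_eq_eSym
  have hlift : HasLogDeriv (PowerSeries.mk P)
      (PowerSeries.mk fun j => (-1) ^ j * X j.succPNat) := by
    refine .of_map (fun _ : Unit => (aeval (R := ℂ) fun k : ℕ+ => pSym k).toRingHom)
      (fun a b h => algebraicIndependent_pSym (h ())) fun _ => ?_
    convert hasLogDeriv_eSym using 1 <;> ext1 j <;> simp [hP]
  convert hlift.map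
    (aeval (R := ℂ) fun k : ℕ+ => MvPowerSeries.expand (k : ℕ) k.ne_zero g).toRingHom using 1 <;>
    ext1 j
  · simp [← hP, plethysm_aeval]
  · simp

theorem expand_pSym (k : ℕ) (hk : k ≠ 0) (d : ℕ) :
    MvPowerSeries.expand k hk (pSym d) = pSym (k * d) := by
  classical
  ext m
  by_cases h : ∃ m', m = k • m'
  · obtain ⟨m, rfl⟩ := h
    rw [MvPowerSeries.coeff_expand_smul, coeff_pSym, coeff_pSym]
    refine if_congr (exists_congr fun i => ?_) rfl rfl
    rw [← smul_eq_mul, ← Finsupp.smul_single]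
    exact (nsmul_right_inj hk).symm
  · obtain ⟨i, hi⟩ : ∃ i, ¬ k ∣ m i := by
      by_contra! hdvd
      refine h ⟨m.mapRange (fun a => a / k) (Nat.zero_div k), Finsupp.ext fun i => ?_⟩
      exact (Nat.mul_div_cancel' (hdvd i)).symm
    rw [MvPowerSeries.coeff_expand_of_not_dvd k hk _ hi, coeff_pSym, if_neg]
    rintro ⟨j, rfl⟩
    exact h ⟨Finsupp.single j d, by rw [Finsupp.smul_single, smul_eq_mul]⟩

end Plethysm

section CycleIndex

theorem cycleShape_conj {n : ℕ} (x g : Perm (Fin n)) : cycleShape (x * g * x⁻¹) = cycleShape g :=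
  isConj_iff_cycleShape_eq.1 (isConj_iff.2 ⟨x, rfl⟩).symm

theorem character_ind_trivial {k G : Type*} [Field k] [CharZero k] [Group G] [Fintype G]
    (H : Subgroup G) [DecidablePred (· ∈ H)] (g : G) :
    (ind H.subtype (trivial k H k)).character g =
      (Nat.card H : k)⁻¹ * ∑ x : G, if x * g * x⁻¹ ∈ H then 1 else 0 := by
  rw [character_ind_subtype]
  simp [character]

theorem frob_ind_trivial {n : ℕ} (H : Subgroup (Perm (Fin n))) [DecidablePred (· ∈ H)] :
    (Nat.card H : ℂ) • frob (ind H.subtype (trivial ℂ H ℂ)) =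
      ∑ g with g ∈ H, pPart (cycleShape g) := by
  have hconj (x : Perm (Fin n)) :
      ∑ g, (if x * g * x⁻¹ ∈ H then (1 : ℂ) else 0) • pPart (cycleShape g) =
        ∑ g with g ∈ H, pPart (cycleShape g) := by
    rw [Finset.sum_filter]
    refine Fintype.sum_equiv (MulAut.conj x).toEquiv _ _ fun g => ?_
    rw [MulEquiv.toEquiv_eq_coe, EquivLike.coe_coe, MulAut.conj_apply, cycleShape_conj, ite_smul,
      one_smul, zero_smul]
  change _ • (n.factorial : ℂ)⁻¹ • ∑ g : Perm (Fin n), _ • pPart (cycleShape g) = _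
  simp_rw [character_ind_trivial, mul_smul, Finset.sum_smul, ← Finset.smul_sum]
  rw [smul_comm, smul_inv_smul₀ (Nat.cast_ne_zero.2 Nat.card_pos.ne'), Finset.sum_comm,
    Fintype.sum_congr _ _ hconj, Finset.sum_const, Finset.card_univ, Fintype.card_perm,
    Fintype.card_fin, ← Nat.cast_smul_eq_nsmul ℂ,
    inv_smul_smul₀ (Nat.cast_ne_zero.2 n.factorial_ne_zero)]

theorem dvd_orderOf_and_exists_pow_apply_eq {n : ℕ} {g : Perm (Fin n)} {i : ℕ}
    (hi : i ∈ (cycleShape g).parts) : i ∣ orderOf g ∧ ∃ x, (g ^ i) x = x := by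
  rcases Multiset.mem_add.1 hi with hi | hi
  · refine ⟨dvd_of_mem_cycleType hi, ?_⟩
    rw [cycleType_def, Multiset.mem_map] at hi
    obtain ⟨c, hc, rfl⟩ := hi
    rw [Finset.mem_val] at hc
    have isCycle_c := (mem_cycleFactorsFinset_iff.1 hc).1
    obtain ⟨x, hx⟩ := isCycle_c.nonempty_support
    refine ⟨x, ?_⟩
    rw [Function.comp_apply, ← isCycle_c.orderOf, cycle_is_cycleOf hx hc,
      ← cycleOf_pow_apply_self, pow_orderOf_eq_one, one_apply]
  · obtain ⟨card_ne, rfl⟩ := Multiset.mem_replicate.1 hi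
    have support_ne : g.support ≠ Finset.univ := fun h => by simp [h] at card_ne
    obtain ⟨x, hx⟩ := not_forall.1 (mt Finset.eq_univ_iff_forall.2 support_ne)
    exact ⟨one_dvd _, x, by rwa [pow_one, ← notMem_support]⟩

theorem parts_cycleShape_of_semiregular {n : ℕ} {g : Perm (Fin n)}
    (hg : ∀ k x, (g ^ k) x = x → g ^ k = 1) :
    (cycleShape g).parts = Multiset.replicate (n / orderOf g) (orderOf g) := by
  have hrep : (cycleShape g).parts = Multiset.replicate _ (orderOf g) :=
    Multiset.eq_replicate_card.2 fun i hi => by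
      obtain ⟨hdvd, x, hx⟩ := dvd_orderOf_and_exists_pow_apply_eq hi
      exact hdvd.antisymm (orderOf_dvd_of_pow_eq_one (hg i x hx))
  have hsum := (cycleShape g).parts_sum
  rw [hrep, Multiset.sum_replicate, smul_eq_mul] at hsum
  rw [hrep, Nat.div_eq_of_eq_mul_left (orderOf_pos g) hsum.symm]

theorem finRotate_pow_apply (m k : ℕ) (x : Fin (m + 1)) :
    (finRotate (m + 1) ^ k) x = x + k • 1 := by
  induction k with
  | zero => simp
  | succ k ih => rw [pow_succ', Perm.mul_apply, finRotate_apply, ih, succ_nsmul, add_assoc]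

theorem finRotate_pow_apply_eq_self_iff {m k : ℕ} {x : Fin (m + 1)} :
    (finRotate (m + 1) ^ k) x = x ↔ k • (1 : Fin (m + 1)) = 0 := by
  rw [finRotate_pow_apply, add_eq_left]

theorem finRotate_pow_eq_one_iff {m k : ℕ} :
    finRotate (m + 1) ^ k = 1 ↔ k • (1 : Fin (m + 1)) = 0 := by
  simp only [Equiv.ext_iff, one_apply, finRotate_pow_apply_eq_self_iff, forall_const]

theorem orderOf_finRotate (m : ℕ) : orderOf (finRotate (m + 1)) = m + 1 := by
  refine (Nat.dvd_right_iff_eq.1 fun k => ?_).trans (ZMod.addOrderOf_one (m + 1))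
  rw [orderOf_dvd_iff_pow_eq_one, addOrderOf_dvd_iff_nsmul_eq_zero]
  exact finRotate_pow_eq_one_iff

theorem parts_cycleShape_of_mem_zpowers_finRotate {m : ℕ} {g : Perm (Fin (m + 1))}
    (hg : g ∈ Subgroup.zpowers (finRotate (m + 1))) :
    (cycleShape g).parts = Multiset.replicate ((m + 1) / orderOf g) (orderOf g) := by
  obtain ⟨j, rfl⟩ := (isOfFinOrder_of_finite _).mem_powers_iff_mem_zpowers.2 hg
  refine parts_cycleShape_of_semiregular fun k x hx => ?_
  rw [← pow_mul] at hx ⊢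
  exact finRotate_pow_eq_one_iff.2 (finRotate_pow_apply_eq_self_iff.1 hx)

theorem sum_eq_sum_divisors_totient_smul {G M : Type*} [Group G] [Fintype G] [IsCyclic G]
    [AddCommMonoid M] (F : ℕ → M) :
    ∑ g : G, F (orderOf g) = ∑ d ∈ (Nat.card G).divisors, d.totient • F d := by
  classical
  rw [← Finset.sum_fiberwise_of_maps_to (t := (Nat.card G).divisors) (g := orderOf) fun g _ =>
    Nat.mem_divisors.2 ⟨orderOf_dvd_natCard g, Nat.card_pos.ne'⟩]
  refine Finset.sum_congr rfl fun d hd => ?_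
  rw [← IsCyclic.card_orderOf_eq_totient
      (Nat.card_eq_fintype_card (α := G) ▸ Nat.dvd_of_mem_divisors hd), ← Finset.sum_const]
  exact Finset.sum_congr rfl fun g hg => by rw [(Finset.mem_filter.1 hg).2]

theorem frob_indCyclic {i : ℕ} (hi : i ≠ 0) :
    (i : ℂ) • frob (indCyclic i) =
      ∑ p ∈ i.divisorsAntidiagonal, p.1.totient • pSym p.1 ^ p.2 := by
  classical
  obtain ⟨m, rfl⟩ := Nat.exists_eq_succ_of_ne_zero hi
  have hcard : Nat.card (Subgroup.zpowers (finRotate (m + 1))) = m + 1 := by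
    rw [Nat.card_zpowers, orderOf_finRotate]
  have hfrob := frob_ind_trivial (Subgroup.zpowers (finRotate (m + 1)))
  have hsum := sum_eq_sum_divisors_totient_smul (G := Subgroup.zpowers (finRotate (m + 1)))
    fun d => pSym d ^ ((m + 1) / d)
  rw [hcard] at hfrob hsum
  rw [hfrob, Nat.sum_divisorsAntidiagonal fun a b => a.totient • pSym a ^ b, ← hsum,
    Finset.sum_subtype _ fun g => Finset.mem_filter_univ g]
  refine Fintype.sum_congr _ _ fun g => ?_
  rw [pPart, parts_cycleShape_of_mem_zpowers_finRotate g.2, Multiset.map_replicate,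
    Multiset.prod_replicate, Subgroup.orderOf_coe]

end CycleIndex

section PartitionSums

open PowerSeries
open scoped PowerSeries.WithPiTopology

variable {R : Type*} [CommRing R]

theorem hasSum_smul_X_pow_mul [TopologicalSpace R] (f : ℕ → R) {i : ℕ} (hi : i ≠ 0) :
    HasSum (fun j => f j • (X : R⟦X⟧) ^ (i * j)) ((PowerSeries.mk f).expand i hi) := by
  rw [WithPiTopology.hasSum_iff_hasSum_coeff]
  intro n
  simp only [coeff_smul, coeff_X_pow, smul_eq_mul, mul_ite, mul_one, mul_zero]
  by_cases h : i ∣ n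
  · obtain ⟨m, rfl⟩ := h
    rw [coeff_expand_mul, coeff_mk]
    simpa only [if_true] using hasSum_single m fun j hj =>
      if_neg fun h => hj (Nat.eq_of_mul_eq_mul_left (Nat.pos_of_ne_zero hi) h).symm
  · rw [coeff_expand_of_not_dvd _ _ _ h]
    exact hasSum_zero.congr_fun fun j => if_neg fun hj : n = i * j => h (Dvd.intro j hj.symm)

theorem hasProd_expand_genFun [TopologicalSpace R] [IsTopologicalRing R] [T2Space R] {f : ℕ → ℕ → R}
    (hf : ∀ i ≠ 0, f i 0 = 1) :
    HasProd (fun i => (PowerSeries.mk (f (i + 1))).expand (i + 1) i.succ_ne_zero)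
      (Nat.Partition.genFun f) := by
  refine (Nat.Partition.hasProd_genFun f).congr_fun fun i => ?_
  have h := hasSum_smul_X_pow_mul (f (i + 1)) i.succ_ne_zero
  rw [← h.tsum_eq, h.summable.tsum_eq_zero_add, hf _ i.succ_ne_zero, mul_zero, pow_zero, one_smul]

theorem coeff_natCast_mul_X_pow_mul_expand (L : R⟦X⟧) (i n : ℕ) :
    coeff n (((i + 1 : ℕ) : R⟦X⟧) * X ^ i * L.expand (i + 1) i.succ_ne_zero) =
      if i + 1 ∣ n + 1 then ((i + 1 : ℕ) : R) * coeff ((n + 1) / (i + 1) - 1) L else 0 := by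
  rw [mul_assoc, ← map_natCast (C (R := R)), coeff_C_mul, coeff_X_pow_mul']
  split_ifs with hle hdvd hdvd
  · obtain ⟨m, hm⟩ := hdvd
    obtain ⟨k, rfl⟩ : ∃ k, m = k + 1 := Nat.exists_eq_succ_of_ne_zero (by rintro rfl; omega)
    have hn : n - i = (i + 1) * k := by rw [mul_add] at hm; omega
    rw [hm, Nat.mul_div_cancel_left _ i.succ_pos, Nat.add_sub_cancel, hn, coeff_expand_mul]
  · rw [coeff_expand_of_not_dvd, mul_zero]
    rintro ⟨m, hm⟩
    exact hdvd ⟨m + 1, by rw [mul_add]; omega⟩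
  · exact absurd (Nat.le_of_dvd n.succ_pos hdvd) (by omega)
  · exact mul_zero _

theorem hasSum_natCast_mul_X_pow_mul_expand [TopologicalSpace R] (L : ℕ → R⟦X⟧) :
    HasSum (fun i => ((i + 1 : ℕ) : R⟦X⟧) * X ^ i * (L (i + 1)).expand (i + 1) i.succ_ne_zero)
      (PowerSeries.mk fun n =>
        ∑ p ∈ (n + 1).divisorsAntidiagonal, (p.1 : R) * coeff (p.2 - 1) (L p.1)) := by
  rw [WithPiTopology.hasSum_iff_hasSum_coeff]
  intro n
  simp only [coeff_natCast_mul_X_pow_mul_expand, coeff_mk]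
  rw [Nat.sum_divisorsAntidiagonal fun i k => (i : R) * coeff (k - 1) (L i), Nat.divisors,
    Finset.sum_filter, Finset.sum_Ico_eq_sum_range]
  simp only [Nat.add_sub_cancel, add_comm 1]
  exact hasSum_sum_of_ne_finset_zero fun i hi => if_neg fun hdvd => hi <| Finset.mem_range.2 <|
    Nat.le_of_dvd n.succ_pos hdvd

theorem HasLogDeriv.genFun {f : ℕ → ℕ → R} {L : ℕ → R⟦X⟧}
    (h : ∀ i ≠ 0, HasLogDeriv (PowerSeries.mk (f i)) (L i)) :
    HasLogDeriv (Nat.Partition.genFun f) (PowerSeries.mk fun n =>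
      ∑ p ∈ (n + 1).divisorsAntidiagonal, (p.1 : R) * coeff (p.2 - 1) (L p.1)) := by
  let _ : TopologicalSpace R := ⊥
  have : DiscreteTopology R := ⟨rfl⟩
  refine HasLogDeriv.hasProd (fun i => (h _ i.succ_ne_zero).expand i.succ_ne_zero)
    (hasProd_expand_genFun fun i hi => ?_) (hasSum_natCast_mul_X_pow_mul_expand L)
  rw [← (h i hi).constantCoeff_eq_one, ← coeff_zero_eq_constantCoeff_apply, coeff_mk]

theorem sum_partition_prod_eq_of_hasLogDeriv [IsAddTorsionFree R]
    {f f' : ℕ → ℕ → R} {L L' : ℕ → R⟦X⟧}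
    (h : ∀ i ≠ 0, HasLogDeriv (PowerSeries.mk (f i)) (L i))
    (h' : ∀ i ≠ 0, HasLogDeriv (PowerSeries.mk (f' i)) (L' i))
    (hL : ∀ n : ℕ, ∑ p ∈ n.divisorsAntidiagonal, (p.1 : R) * coeff (p.2 - 1) (L p.1) =
      ∑ p ∈ n.divisorsAntidiagonal, (p.1 : R) * coeff (p.2 - 1) (L' p.1)) (n : ℕ) :
    ∑ l : n.Partition, ∏ i ∈ l.parts.toFinset, f i (l.parts.count i) =
      ∑ l : n.Partition, ∏ i ∈ l.parts.toFinset, f' i (l.parts.count i) := by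
  have hgen := HasLogDeriv.genFun h
  simp only [hL] at hgen
  simpa only [Nat.Partition.coeff_genFun, Finsupp.prod, Multiset.toFinsupp_support,
    Multiset.toFinsupp_apply] using congrArg (coeff n) (hgen.unique (HasLogDeriv.genFun h'))

theorem hasLogDeriv_mk_pow (x : R) :
    HasLogDeriv (PowerSeries.mk fun c => x ^ c) (PowerSeries.mk fun j => x ^ (j + 1)) where
  constantCoeff_eq_one := by
    rw [← coeff_zero_eq_constantCoeff_apply, coeff_mk, pow_zero]
  derivative_eq := by
    ext n
    have hterm : ∀ p ∈ Finset.HasAntidiagonal.antidiagonal n,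
        x ^ (p.1 + 1) * x ^ p.2 = x ^ (n + 1) := fun p hp => by
      rw [← pow_add, add_right_comm, Finset.HasAntidiagonal.mem_antidiagonal.1 hp]
    simp only [coeff_derivative, coeff_mul, coeff_mk]
    rw [Finset.sum_congr rfl hterm, Finset.sum_const, Finset.Nat.card_antidiagonal, nsmul_eq_mul,
      mul_comm, Nat.cast_succ]

end PartitionSums

section PlethysticSum

theorem sum_divisorsAntidiagonal_totient (m : ℕ) :
    ∑ p ∈ m.divisorsAntidiagonal, p.2.totient = m := by
  rw [Nat.sum_divisorsAntidiagonal' fun _ d => d.totient, Nat.sum_totient]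

theorem sum_even_divisorsAntidiagonal {M : Type*} [AddCommMonoid M] (F : ℕ → M) (r : ℕ) :
    ∑ p ∈ (2 * r).divisorsAntidiagonal with Even p.1, F p.2 =
      ∑ p ∈ r.divisorsAntidiagonal, F p.2 := by
  symm
  refine Finset.sum_nbij (fun p => (2 * p.1, p.2)) ?_ ?_ ?_ fun _ _ => rfl
  · rintro ⟨a, b⟩ h
    simp only [Finset.mem_filter, Nat.mem_divisorsAntidiagonal] at h ⊢
    exact ⟨⟨by rw [mul_assoc, h.1], by omega⟩, even_two_mul a⟩
  · rintro ⟨a, b⟩ _ ⟨c, d⟩ _ h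
    simpa only [Prod.mk.injEq, mul_eq_mul_left_iff, OfNat.ofNat_ne_zero, or_false] using h
  · rintro ⟨a, b⟩ h
    simp only [Finset.coe_filter, Nat.mem_divisorsAntidiagonal, Set.mem_ofPred_eq] at h
    obtain ⟨⟨hab, h0⟩, heven⟩ := h
    obtain ⟨c, rfl⟩ := even_iff_two_dvd.1 heven
    refine ⟨(c, b), ?_, rfl⟩
    simp only [Finset.mem_coe, Nat.mem_divisorsAntidiagonal]
    exact ⟨Nat.eq_of_mul_eq_mul_left two_pos (by rw [← mul_assoc, hab]), by omega⟩

theorem neg_one_pow_sub_one {R : Type*} [CommRing R] {k : ℕ} (hk : k ≠ 0) :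
    (-1 : R) ^ (k - 1) = 1 - 2 * if Even k then 1 else 0 := by
  obtain ⟨j, rfl⟩ := Nat.exists_eq_succ_of_ne_zero hk
  rw [Nat.succ_eq_add_one, Nat.add_sub_cancel]
  rcases Nat.even_or_odd j with hj | hj
  · rw [hj.neg_one_pow, if_neg (Nat.not_even_iff_odd.2 hj.add_one), mul_zero, sub_zero]
  · rw [hj.neg_one_pow, if_pos hj.add_one]
    norm_num

theorem sum_neg_one_pow_mul_totient {R : Type*} [CommRing R] (m : ℕ) :
    ∑ p ∈ m.divisorsAntidiagonal, (-1 : R) ^ (p.1 - 1) * p.2.totient =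
      if Odd m then (m : R) else 0 := by
  have hsign : ∀ p ∈ m.divisorsAntidiagonal, (-1 : R) ^ (p.1 - 1) * p.2.totient =
      p.2.totient - 2 * if Even p.1 then (p.2.totient : R) else 0 := fun p hp => by
    rw [neg_one_pow_sub_one (Nat.ne_zero_of_mem_divisorsAntidiagonal hp).1, sub_mul, one_mul,
      mul_assoc, ite_mul, one_mul, zero_mul]
  rw [Finset.sum_congr rfl hsign, Finset.sum_sub_distrib, ← Finset.mul_sum, ← Finset.sum_filter,
    ← Nat.cast_sum, ← Nat.cast_sum, sum_divisorsAntidiagonal_totient]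
  split_ifs with hm
  · have hodd : ∀ p ∈ m.divisorsAntidiagonal, ¬Even p.1 := fun p hp heven =>
      Nat.not_even_iff_odd.2 hm ((Nat.mem_divisorsAntidiagonal.1 hp).1 ▸ heven.mul_right _)
    rw [Finset.filter_false_of_mem hodd, Finset.sum_empty, Nat.cast_zero, mul_zero, sub_zero]
  · obtain ⟨r, rfl⟩ := even_iff_two_dvd.1 (Nat.not_odd_iff_even.1 hm)
    rw [sum_even_divisorsAntidiagonal, sum_divisorsAntidiagonal_totient, Nat.cast_mul,
      Nat.cast_two, sub_self]

theorem sum_divisorsAntidiagonal_rotate {M : Type*} [AddCommMonoid M] (n : ℕ)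
    (F : ℕ → ℕ → ℕ → M) :
    ∑ p ∈ n.divisorsAntidiagonal, ∑ q ∈ p.1.divisorsAntidiagonal, F p.2 q.1 q.2 =
      ∑ p ∈ n.divisorsAntidiagonal, ∑ q ∈ p.1.divisorsAntidiagonal, F q.1 q.2 p.2 := by
  rw [Finset.sum_sigma', Finset.sum_sigma']
  refine Finset.sum_nbij' (fun x => ⟨(x.1.2 * x.2.1, x.2.2), (x.1.2, x.2.1)⟩)
    (fun x => ⟨(x.2.2 * x.1.2, x.2.1), (x.2.2, x.1.2)⟩) ?_ ?_ ?_ ?_ fun _ _ => rfl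
  all_goals
    rintro ⟨⟨a, b⟩, c, d⟩ h
    simp only [Finset.mem_sigma, Nat.mem_divisorsAntidiagonal] at h ⊢
    obtain ⟨⟨rfl, h⟩, rfl, -⟩ := h
    simp_all [mul_comm, mul_left_comm]

theorem natCast_mul_neg_one_pow_mul_expand_frob_indCyclic {i : ℕ} (hi : i ≠ 0) (j : ℕ) :
    (i : MvPowerSeries ℕ ℂ) *
        ((-1) ^ j * MvPowerSeries.expand (j + 1) j.succ_ne_zero (frob (indCyclic i))) =
      ∑ p ∈ i.divisorsAntidiagonal, (-1) ^ j * p.1.totient * pSym ((j + 1) * p.1) ^ p.2 := by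
  have h := congrArg (MvPowerSeries.expand (j + 1) j.succ_ne_zero) (frob_indCyclic hi)
  simp only [Nat.cast_smul_eq_nsmul, nsmul_eq_mul, map_mul, map_natCast, map_sum, map_pow,
    expand_pSym] at h
  rw [mul_left_comm, h, Finset.mul_sum]
  exact Finset.sum_congr rfl fun p _ => (mul_assoc _ _ _).symm

theorem natCast_mul_ite_odd_pSym_pow (i k : ℕ) :
    ((i : MvPowerSeries ℕ ℂ) * if Odd i then pSym i ^ k else 0) =
      ∑ p ∈ i.divisorsAntidiagonal, (-1) ^ (p.1 - 1) * p.2.totient * pSym (p.1 * p.2) ^ k := by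
  rw [← Finset.sum_congr rfl fun p hp => by rw [(Nat.mem_divisorsAntidiagonal.1 hp).1],
    ← Finset.sum_mul, sum_neg_one_pow_mul_totient, mul_ite, ite_mul, mul_zero, zero_mul]

theorem sum_logDeriv_plethysm_eq_sum_logDeriv_odd (n : ℕ) :
    ∑ p ∈ n.divisorsAntidiagonal, (p.1 : MvPowerSeries ℕ ℂ) *
        ((-1) ^ (p.2 - 1) *
          MvPowerSeries.expand (p.2 - 1 + 1) (p.2 - 1).succ_ne_zero (frob (indCyclic p.1))) =
      ∑ p ∈ n.divisorsAntidiagonal, (p.1 : MvPowerSeries ℕ ℂ) *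
        if Odd p.1 then pSym p.1 ^ p.2 else 0 := by
  simp only [natCast_mul_ite_odd_pSym_pow]
  rw [← sum_divisorsAntidiagonal_rotate n fun k d e =>
    (-1) ^ (k - 1) * (d.totient : MvPowerSeries ℕ ℂ) * pSym (k * d) ^ e]
  refine Finset.sum_congr rfl fun p hp => ?_
  obtain ⟨hi, hk⟩ := Nat.ne_zero_of_mem_divisorsAntidiagonal hp
  rw [natCast_mul_neg_one_pow_mul_expand_frob_indCyclic hi, Nat.sub_one_add_one hk]

theorem hasLogDeriv_mk_ite_odd_pSym_pow (i : ℕ) :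
    HasLogDeriv
      (PowerSeries.mk fun c => if Odd i then pSym i ^ c else if c = 0 then 1 else 0)
      (PowerSeries.mk fun j => if Odd i then pSym i ^ (j + 1) else 0) := by
  by_cases hi : Odd i
  · simpa only [if_pos hi] using hasLogDeriv_mk_pow (pSym i)
  · simp only [if_neg hi]
    convert HasLogDeriv.one using 1 <;> ext n <;> simp [PowerSeries.coeff_one]

theorem sum_partition_prod_ite_odd {R : Type*} [CommRing R] (q : ℕ → R) (n : ℕ) :
    (∑ l : n.Partition, ∏ i ∈ l.parts.toFinset, if Odd i then q i ^ l.parts.count i else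
      if l.parts.count i = 0 then 1 else 0) =
      ∑ l ∈ Nat.Partition.odds n, (l.parts.map q).prod := by
  rw [← Finset.sum_subset (Finset.subset_univ (Nat.Partition.odds n))]
  · refine Finset.sum_congr rfl fun l hl => ?_
    rw [Finset.prod_multiset_map_count]
    exact Finset.prod_congr rfl fun i hi =>
      if_pos (mem_odds_iff.1 hl i (Multiset.mem_toFinset.1 hi))
  · intro l _ hl
    obtain ⟨i, hi, hodd⟩ : ∃ i ∈ l.parts, ¬Odd i := by simpa [mem_odds_iff] using hl
    refine Finset.prod_eq_zero (Multiset.mem_toFinset.2 hi) ?_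
    rw [if_neg hodd, if_neg (Multiset.count_ne_zero.2 hi)]

theorem sum_ePleth (n : ℕ) :
    ∑ l : n.Partition, ePleth l (fun i => frob (indCyclic i)) =
      ∑ l ∈ Nat.Partition.odds n, pPart l := by
  have : IsAddTorsionFree (MvPowerSeries ℕ ℂ) := .of_module_rat _
  refine (sum_partition_prod_eq_of_hasLogDeriv
    (fun i _ => hasLogDeriv_plethysm (frob (indCyclic i)))
    (fun i _ => hasLogDeriv_mk_ite_odd_pSym_pow i) (fun m => ?_) n).trans
    (sum_partition_prod_ite_odd pSym n)
  simp only [PowerSeries.coeff_mk]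
  rw [sum_logDeriv_plethysm_eq_sum_logDeriv_odd]
  exact Finset.sum_congr rfl fun p hp => by
    rw [Nat.sub_one_add_one (Nat.ne_zero_of_mem_divisorsAntidiagonal hp).2]

end PlethysticSum

end TwistedConj

end

open TwistedConj in
theorem theorem4p6 (n : ℕ) :
    frob (twistedConj n) = ∑ l : n.Partition, ePleth l (fun i => frob (indCyclic i)) ∧
    frob (twistedConj n) = ∑ l ∈ Nat.Partition.odds n, pPart l ∧
    Nonempty (((twistedConj n).tprod (sgnRep n)).Equiv (twistedConj n)) ∧
    Module.finrank ℂ (TwistedSpace n) = n.factorial ∧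
    ∀ ν : n.Partition, ∃ k : ℕ, ∑ l ∈ Nat.Partition.odds n, irrChar ν l = (k : ℂ) :=
  ⟨(frob_twistedConj n).trans (sum_ePleth n).symm, frob_twistedConj n,
    nonempty_twistedConj_tprod_sgnRep_equiv n, finrank_twistedSpace n,
    exists_natCast_eq_sum_irrChar⟩
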